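/- Consider a user at distance $r>0$ from its base station and $N$ interfering base stations at distances $d_1,\dots,d_N>0$, with common transmit power $P>0$ and path loss exponent $\beta$. Write $\mathcal G(\alpha,\lambda)$ for the gamma law with shape $\alpha>0$ and scale $\lambda>0$. The user's channel power is $g\sim\mathcal G(\alpha_u,\lambda_u)$, the interferers' channel powers are $h_i\sim\mathcal G(\alpha_c,\lambda_i)$ with a common shape $\alpha_c$, and $g$ is independent of $(h_1,\dots,h_N)$. The coverage probability at threshold $T>0$ is $$\mathbb P(\eta>T),\qquad \eta=\frac{P g r^{-\beta}}{\sum_{i=1}^N P h_i d_i^{-\beta}} .$$ Let $P_c(T)$ be the coverage probability when $h_1,\dots,h_N$ are independent, and put $\lambda'_i=\lambda_i d_i^{-\beta}$. Let $\rho_{ij}=\rho_{ji}\in[0,1]$ be correlation coefficients such that the $N\times N$ matrix $C$ with diagonal entries $1$ and off-diagonal entries $\sqrt{\rho_{ij}}$ is positive definite. Let $P_c^c(T)$ be the coverage probability when $(h_1,\dots,h_N)$ are correlated with coefficients $\rho_{ij}$, that is, have the multivariate gamma law on $[0,\infty)^N$ with Laplace transform $$\mathbb E\, e^{-\sum_i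 s_i h_i}=\det\bigl(I+\operatorname{diag}(s_1,\dots,s_N)\operatorname{diag}(\lambda_1,\dots,\lambda_N)\,C\bigr)^{-\alpha_c}\qquad(s_1,\dots,s_N\ge 0).$$ (1) Suppose $\alpha_u\le 1$. Then $P_c^c(T)\ge P_c(T)$ for every $T>0$. Likewise, let $\hat\lambda_1,\dots,\hat\lambda_N$ be the eigenvalues, with multiplicity, of $A=DC$, where $D=\operatorname{diag}(\lambda'_1,\dots,\lambda'_N)$. If the total interference is $\hat I=\sum_i\hat\lambda_iG_i$ with $G_1,\dots,G_N$ independent, $\mathcal G(\alpha_c,1)$-distributed and independent of $g$, then $\mathbb P(g r^{-\beta}/\hat I>T)\ge P_c(T)$ for every $T>0$ (whether or not the multivariate gamma law above exists for this $\alpha_c$ and $C$). (2) If $\alpha_u>1$, the order can go either way: for every $\alpha_u>1$ there are networks, with $\alpha_c\ge\tfrac12$, $\beta\ge2$ and $r<d_i$ for all $i$, coefficients $\rho_{ij}$ as above for which the multivariate gamma law exists, and thresholds $T>0$, for which $P_c^c(T)<P_c(T)$, and there are also such choices for which $P_c^c(T)>P_c(T)$. -/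

import Mathlib

open MeasureTheory ProbabilityTheory

/-- The gamma distribution `𝒢(α, θ)` with shape `α` and *scale* `θ`, i.e. with density
`y ^ (α - 1) * exp (-y / θ) / (θ ^ α * Γ(α))` on `y ≥ 0` (Mathlib's parameter is the rate). -/
noncomputable def gammaLaw (α θ : ℝ) : Measure ℝ := gammaMeasure α θ⁻¹

/-- The parameters of a downlink with `N` interfering base stations. -/
structure Network (N : ℕ) where
  /-- common transmit power of the base stations -/
  power : ℝ
  /-- path loss exponent -/
  β : ℝ
  /-- distance from the user to its own base station -/
  r : ℝ
  /-- distances from the user to the interfering base stations -/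
  d : Fin N → ℝ
  /-- shape parameter of the user channel -/
  αu : ℝ
  /-- scale parameter of the user channel -/
  θu : ℝ
  /-- common shape parameter of the interfering channels -/
  αc : ℝ
  /-- scale parameters of the interfering channels -/
  θ : Fin N → ℝ
  power_pos : 0 < power
  r_pos : 0 < r
  d_pos : ∀ i, 0 < d i
  αu_pos : 0 < αu
  θu_pos : 0 < θu
  αc_pos : 0 < αc
  θ_pos : ∀ i, 0 < θ i

namespace Network

variable {N : ℕ}

/-- The scale parameters `λ'ᵢ = λᵢ dᵢ ^ (-β)` of the received interference powers. -/
noncomputable def receivedScale (n : Network N) (i : Fin N) : ℝ := n.θ i * n.d i ^ (-n.β)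

/-- The signal-to-interference ratio, for channel powers `g` (user) and `h` (interferers). -/
noncomputable def sir (n : Network N) (g : ℝ) (h : Fin N → ℝ) : ℝ :=
  n.power * g * n.r ^ (-n.β) / ∑ i, n.power * h i * n.d i ^ (-n.β)

/-- The coverage probability `P(η > T)`, when the channel powers of the interferers have joint
law `ν` and the channel power of the user is `𝒢(αu, θu)` and independent of them. -/
noncomputable def coverage (n : Network N) (ν : Measure (Fin N → ℝ)) (T : ℝ) : ℝ :=
  ((gammaLaw n.αu n.θu).prod ν).real {x | T < n.sir x.1 x.2}

/-- The joint law of independent interferers, `hᵢ ∼ 𝒢(αc, θᵢ)`. -/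
noncomputable def indepLaw (n : Network N) : Measure (Fin N → ℝ) :=
  Measure.pi fun i => gammaLaw n.αc (n.θ i)

end Network

/-- The matrix `C` with diagonal entries `1` and off-diagonal entries `√ρᵢⱼ`. -/
noncomputable def corrMatrix {N : ℕ} (ρ : Fin N → Fin N → ℝ) : Matrix (Fin N) (Fin N) ℝ :=
  Matrix.of fun i j => if i = j then 1 else √(ρ i j)

/-- Admissible correlation coefficients of positively correlated interferers: `ρᵢⱼ = ρⱼᵢ ∈ [0, 1]`
and the matrix with entries `√ρᵢⱼ` is positive definite. -/
structure IsCorrelation {N : ℕ} (ρ : Fin N → Fin N → ℝ) : Prop where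
  symm : ∀ i j, ρ i j = ρ j i
  nonneg : ∀ i j, 0 ≤ ρ i j
  le_one : ∀ i j, ρ i j ≤ 1
  posDef : (corrMatrix ρ).PosDef

/-- `ν` is the multivariate gamma law (of Krishnamoorthy and Parthasarathy) with shape `α`, scales
`θ` and matrix `C`: it lives on the nonnegative orthant and its Laplace transform is
`E exp (-∑ sᵢ Yᵢ) = det (1 + diag(s) diag(θ) C) ^ (-α)`.
For `C = corrMatrix ρ` its margins are `𝒢(α, θᵢ)` and the correlation coefficient of the `i`-th and
the `j`-th coordinate is `ρᵢⱼ`; for `ρ = 0` off the diagonal the coordinates are independent. -/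
structure IsMultivariateGamma {N : ℕ} (α : ℝ) (θ : Fin N → ℝ) (C : Matrix (Fin N) (Fin N) ℝ)
    (ν : Measure (Fin N → ℝ)) : Prop where
  isProbabilityMeasure : IsProbabilityMeasure ν
  nonneg : ∀ᵐ y ∂ν, ∀ i, 0 ≤ y i
  laplace : ∀ s : Fin N → ℝ, (∀ i, 0 ≤ s i) →
    ∫ y, Real.exp (-∑ i, s i * y i) ∂ν =
      (1 + Matrix.diagonal s * (Matrix.diagonal θ * C)).det ^ (-α)

namespace Network

variable {N : ℕ}

/-- `ν` is the joint law of correlated interferers with the same shape and the same scale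
parameters as in `n`, and with correlation coefficients `ρ`. -/
def IsCorrelatedLaw (n : Network N) (ρ : Fin N → Fin N → ℝ) (ν : Measure (Fin N → ℝ)) : Prop :=
  IsMultivariateGamma n.αc n.θ (corrMatrix ρ) ν

/-- The matrix `A = D C`, where `D` is diagonal with entries `λ'ᵢ`. -/
noncomputable def matrixA (n : Network N) (ρ : Fin N → Fin N → ℝ) : Matrix (Fin N) (Fin N) ℝ :=
  Matrix.diagonal n.receivedScale * corrMatrix ρ

/-- The coverage probability `P(g r ^ (-β) / Î > T)`, where `Î = ∑ i, μᵢ Gᵢ` with i.i.d.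
`Gᵢ ∼ 𝒢(αc, 1)` and `g ∼ 𝒢(αu, θu)` independent of them. -/
noncomputable def coverageOfScales (n : Network N) (μ : Fin N → ℝ) (T : ℝ) : ℝ :=
  ((gammaLaw n.αu n.θu).prod (Measure.pi fun _ : Fin N => gammaLaw n.αc 1)).real
    {x | T < x.1 * n.r ^ (-n.β) / ∑ i, μ i * x.2 i}

end Network

/-! Write `k = θu⁻¹` and `c = T / r ^ (-β)`, so that coverage is the event `g / I > c` with `I` the
interference stripped of transmit power.

Shape at most one: `y ^ (αu - 1)` is then a mixture of exponentials `exp (-t y)`, `t ≥ 0`, and hence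
so is the tail of `g`. By Tonelli, the probability of `g > c I` is a positive mixture of values `E
exp (-(k + t) c I)`, so coverage is monotone in the Laplace transform of `I`
(`prod_gammaLaw_setOf_lt_div_le`). That transform is `∏ (1 + s λ'ᵢ) ^ (-αc)` for independent
interferers and `det (1 + s A) ^ (-αc)` both for correlated ones and for the eigenvalue sum. Since
`A = D C` has the characteristic polynomial of the symmetric matrix `√D C √D`, whose diagonal is
that of `D`, Hadamard's inequality gives `det (1 + s A) ≤ ∏ (1 + s λ'ᵢ)`, and the negative exponent
reverses it.

Shape `p > 1`: one network serves for both directions. With two interferers, shape `1/2` and unit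
received scales, channel powers are squares of normal variables. Independent interference is `u² +
v²`, correlated interference `a u² + b v²` with `a + b = 2` and `a b < 1`. As `c → 0` the outage is
asymptotic to `c ^ p E I ^ p / (Γ(p) p)`, and strict convexity of `x ^ p` makes the correlated
moment larger, so correlation hurts. As `c → ∞` only the mass of `I` near `0` counts; it is governed
by the area of the ellipse `I < y`, proportional to `y / √(a b)`, so correlation helps. -/

/-! ### Determinants: Hadamard's inequality and the spectrum of `D C`. -/

/-- **Hadamard's inequality** for positive definite matrices with unit diagonal. -/
lemma Matrix.PosDef.det_le_one_of_diag_eq_one {n : Type*} [Fintype n] [DecidableEq n]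
    {M : Matrix n n ℝ} (hM : M.PosDef) (h1 : ∀ i, M i i = 1) : M.det ≤ 1 := by
  have hdet : M.det = ∏ i, hM.isHermitian.eigenvalues i := by
    simpa using hM.isHermitian.det_eq_prod_eigenvalues
  have htr : ∑ i, hM.isHermitian.eigenvalues i = Fintype.card n := by
    have := hM.isHermitian.trace_eq_sum_eigenvalues
    simpa [Matrix.trace, h1] using this.symm
  calc M.det = ∏ i, hM.isHermitian.eigenvalues i := hdet
    -- The bound `x ≤ exp (x - 1)` replaces the AM-GM inequality: the eigenvalues have sum `n`, so
    -- the exponents add up to `0`.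
    _ ≤ ∏ i, Real.exp (hM.isHermitian.eigenvalues i - 1) := by
        refine Finset.prod_le_prod (fun i _ => (hM.eigenvalues_pos i).le) fun i _ => ?_
        linarith [Real.add_one_le_exp (hM.isHermitian.eigenvalues i - 1)]
    _ = 1 := by rw [← Real.exp_sum, Finset.sum_sub_distrib, htr]; simp

/-- Scaling a positive definite matrix on both sides by a positive diagonal matrix. -/
lemma Matrix.PosDef.diagonal_mul_mul_diagonal {n : Type*} [Fintype n] [DecidableEq n]
    {M : Matrix n n ℝ} (hM : M.PosDef) {d : n → ℝ} (hd : ∀ i, 0 < d i) :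
    (diagonal d * M * diagonal d).PosDef := by
  have h := hM.conjTranspose_mul_mul_same (B := diagonal d) (by
    intro v w h
    ext i
    have := congrFun h i
    simp only [mulVec_diagonal] at this
    exact mul_left_cancel₀ (hd i).ne' this)
  simpa [diagonal_conjTranspose] using h

/-- **Hadamard's inequality** for positive definite matrices. -/
lemma Matrix.PosDef.det_le_prod_diag {n : Type*} [Fintype n] [DecidableEq n]
    {M : Matrix n n ℝ} (hM : M.PosDef) : M.det ≤ ∏ i, M i i := by
  have hpos : ∀ i, 0 < M i i := fun i => hM.diag_pos
  have hs : ∀ i, 0 < (√(M i i))⁻¹ := fun i => inv_pos.2 (Real.sqrt_pos.2 (hpos i))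
  have h := (hM.diagonal_mul_mul_diagonal hs).det_le_one_of_diag_eq_one (fun i => by
    rw [mul_diagonal, diagonal_mul, mul_right_comm, ← mul_inv, Real.mul_self_sqrt (hpos i).le,
      inv_mul_cancel₀ (hpos i).ne'])
  rw [det_mul, det_mul, det_diagonal, mul_right_comm, ← Finset.prod_mul_distrib,
    Finset.prod_congr rfl (g := fun i => (M i i)⁻¹)
      (fun i _ => by rw [← mul_inv, Real.mul_self_sqrt (hpos i).le]),
    Finset.prod_inv_distrib, inv_mul_le_iff₀ (Finset.prod_pos fun i _ => hpos i), mul_one] at h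
  exact h

/-- For `s ≠ 0` the determinant is `(-s) ^ n` times the characteristic polynomial at `-1/s`. -/
lemma Matrix.det_one_add_smul_eq_prod {n : Type*} [Fintype n] [DecidableEq n]
    {A : Matrix n n ℝ} {μ : n → ℝ}
    (h : A.charpoly = ∏ i, (Polynomial.X - Polynomial.C (μ i))) (s : ℝ) :
    (1 + s • A).det = ∏ i, (1 + s * μ i) := by
  rcases eq_or_ne s 0 with rfl | hs
  · simp
  have h1 : (1 + s • A) = (-s) • (scalar n (-s⁻¹) - A) := by
    ext i j
    by_cases hij : i = j
    · subst hij; simp [scalar_apply]; field_simp; ring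
    · simp [scalar_apply, hij]
  rw [h1, det_smul, ← eval_charpoly, h, Polynomial.eval_prod, ← Finset.card_univ,
    ← Finset.prod_const, ← Finset.prod_mul_distrib]
  refine Finset.prod_congr rfl fun i _ => ?_
  simp only [Polynomial.eval_sub, Polynomial.eval_X, Polynomial.eval_C]
  field_simp
  ring

section DiagonalMul

variable {n : Type*} [Fintype n] [DecidableEq n]

lemma Matrix.diagonal_eq_sqrt_mul_sqrt {d : n → ℝ} (hd : ∀ i, 0 < d i) :
    diagonal d = diagonal (fun i => √(d i)) * diagonal (fun i => √(d i)) := by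
  rw [diagonal_mul_diagonal]
  congr 1
  ext i
  exact (Real.mul_self_sqrt (hd i).le).symm

/-- The eigenvalues of `D * C`, with `D` positive diagonal and `C` positive definite. -/
lemma Matrix.PosDef.exists_charpoly_diagonal_mul {C : Matrix n n ℝ} (hC : C.PosDef) {d : n → ℝ}
    (hd : ∀ i, 0 < d i) : ∃ e : n → ℝ, (∀ i, 0 < e i) ∧
      (diagonal d * C).charpoly = ∏ i, (Polynomial.X - Polynomial.C (e i)) := by
  have hM := hC.diagonal_mul_mul_diagonal (d := fun i => √(d i)) fun i => Real.sqrt_pos.2 (hd i)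
  refine ⟨hM.isHermitian.eigenvalues, hM.eigenvalues_pos, ?_⟩
  -- `charpoly (X Y) = charpoly (Y X)` moves one factor `√D` to the right of `C`, which makes the
  -- matrix symmetric.
  rw [diagonal_eq_sqrt_mul_sqrt hd, mul_assoc, charpoly_mul_comm]
  simpa using hM.isHermitian.charpoly_eq

/-- The list `μ` is any enumeration of the roots; each entry is a root, hence one of the positive
eigenvalues of `√D C √D`. -/
lemma Matrix.PosDef.pos_of_charpoly_diagonal_mul {C : Matrix n n ℝ} (hC : C.PosDef) {d : n → ℝ}
    (hd : ∀ i, 0 < d i) {μ : n → ℝ}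
    (hμ : (diagonal d * C).charpoly = ∏ i, (Polynomial.X - Polynomial.C (μ i))) (i : n) :
    0 < μ i := by
  obtain ⟨e, he, h⟩ := hC.exists_charpoly_diagonal_mul hd
  have h0 : (∏ j, (Polynomial.X - Polynomial.C (e j))).eval (μ i) = 0 := by
    rw [← h, hμ, Polynomial.eval_prod]
    exact Finset.prod_eq_zero (Finset.mem_univ i) (by simp)
  rw [Polynomial.eval_prod, Finset.prod_eq_zero_iff] at h0
  obtain ⟨j, -, hj⟩ := h0
  have : μ i = e j := by simpa [sub_eq_zero] using hj
  rw [this]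
  exact he j

/-- Moving `√D` across the determinant leaves `1 + s √D C √D`, positive definite with diagonal
entries `1 + s dᵢ`, to which Hadamard's inequality applies. -/
lemma Matrix.PosDef.det_one_add_smul_diagonal_mul_le {C : Matrix n n ℝ} (hC : C.PosDef)
    (h1 : ∀ i, C i i = 1) {d : n → ℝ} (hd : ∀ i, 0 < d i) {s : ℝ} (hs : 0 ≤ s) :
    (1 + s • (diagonal d * C)).det ≤ ∏ i, (1 + s * d i) := by
  have hM := hC.diagonal_mul_mul_diagonal (d := fun i => √(d i)) fun i => Real.sqrt_pos.2 (hd i)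
  rw [diagonal_eq_sqrt_mul_sqrt hd, mul_assoc, ← smul_mul_assoc, det_one_add_mul_comm,
    mul_smul_comm]
  have h := (PosDef.one.add_posSemidef (hM.posSemidef.smul hs)).det_le_prod_diag
  refine h.trans_eq (Finset.prod_congr rfl fun i _ => ?_)
  have : √(d i) * √(d i) = d i := Real.mul_self_sqrt (hd i).le
  simp [mul_diagonal, h1, this]

end DiagonalMul

/-! ### The gamma law: Laplace transform and exponential mixtures. -/

lemma gammaLaw_eq_withDensity (α θ : ℝ) :
    gammaLaw α θ = volume.withDensity (gammaPDF α θ⁻¹) := rfl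

lemma measurable_gammaPDF (α r : ℝ) : Measurable (gammaPDF α r) :=
  (measurable_gammaPDFReal α r).ennreal_ofReal

lemma isProbabilityMeasure_gammaLaw {α θ : ℝ} (hα : 0 < α) (hθ : 0 < θ) :
    IsProbabilityMeasure (gammaLaw α θ) :=
  isProbabilityMeasure_gammaMeasure hα (inv_pos.2 hθ)

lemma ae_pos_gammaLaw (α θ : ℝ) : ∀ᵐ x ∂gammaLaw α θ, 0 < x := by
  rw [gammaLaw_eq_withDensity, ae_withDensity_iff (measurable_gammaPDF _ _)]
  have h0 : ∀ᵐ x : ℝ, x ≠ 0 := by simp [ae_iff]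
  filter_upwards [h0] with x hx hpdf
  by_contra hneg
  exact hpdf (gammaPDF_of_neg (lt_of_le_of_ne (not_lt.1 hneg) hx))

lemma lintegral_gammaLaw {α θ : ℝ} {f : ℝ → ENNReal} (hf : Measurable f) :
    ∫⁻ x, f x ∂gammaLaw α θ = ∫⁻ x in Set.Ioi 0,
      ENNReal.ofReal (θ⁻¹ ^ α / Real.Gamma α * x ^ (α - 1) * Real.exp (-(θ⁻¹ * x))) * f x := by
  rw [gammaLaw_eq_withDensity, lintegral_withDensity_eq_lintegral_mul _ (measurable_gammaPDF _ _) hf,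
    ← lintegral_add_compl _ (measurableSet_Ici (a := (0 : ℝ)))]
  have h2 : ∫⁻ x in (Set.Ici (0 : ℝ))ᶜ, (gammaPDF α θ⁻¹ * f) x = 0 := by
    rw [setLIntegral_congr_fun (g := fun _ => 0) measurableSet_Ici.compl]
    · simp
    · intro x hx
      have : x < 0 := by simpa using hx
      simp [gammaPDF_of_neg this]
  rw [h2, add_zero, ← restrict_Ioi_eq_restrict_Ici]
  refine setLIntegral_congr_fun measurableSet_Ioi fun x hx => ?_
  simp [gammaPDF_of_nonneg (le_of_lt (Set.mem_Ioi.1 hx))]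

/-- The Laplace transform of the gamma law. -/
lemma lintegral_exp_gammaLaw {α θ s : ℝ} (hα : 0 < α) (hθ : 0 < θ) (hs : 0 ≤ s) :
    ∫⁻ x, ENNReal.ofReal (Real.exp (-(s * x))) ∂gammaLaw α θ
      = ENNReal.ofReal ((1 + s * θ) ^ (-α)) := by
  have hr : 0 < θ⁻¹ + s := add_pos_of_pos_of_nonneg (inv_pos.2 hθ) hs
  have hΓ := Real.Gamma_pos_of_pos hα
  rw [lintegral_gammaLaw (by fun_prop)]
  have h1 : ∀ x ∈ Set.Ioi (0 : ℝ),
      ENNReal.ofReal (θ⁻¹ ^ α / Real.Gamma α * x ^ (α - 1) * Real.exp (-(θ⁻¹ * x))) *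
        ENNReal.ofReal (Real.exp (-(s * x))) =
      ENNReal.ofReal (θ⁻¹ ^ α / Real.Gamma α *
        (x ^ (α - 1) * Real.exp (-((θ⁻¹ + s) * x)))) := by
    intro x hx
    rw [← ENNReal.ofReal_mul' (Real.exp_pos _).le, mul_assoc, mul_assoc, ← Real.exp_add]
    ring_nf
  have hI : ∫ x in Set.Ioi (0 : ℝ), x ^ (α - 1) * Real.exp (-((θ⁻¹ + s) * x))
      = (1 / (θ⁻¹ + s)) ^ α * Real.Gamma α := Real.integral_rpow_mul_exp_neg_mul_Ioi hα hr
  have hint : IntegrableOn (fun x : ℝ => x ^ (α - 1) * Real.exp (-((θ⁻¹ + s) * x)))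
      (Set.Ioi 0) := by
    -- The Bochner integral of a non-integrable function is `0` by convention, so a nonzero value
    -- already proves integrability.
    refine Integrable.of_integral_ne_zero ?_
    rw [hI]
    positivity
  rw [setLIntegral_congr_fun measurableSet_Ioi h1, ← ofReal_integral_eq_lintegral_ofReal
    (hint.const_mul _), integral_const_mul, hI]
  · congr 1
    have hc : θ⁻¹ ^ α / Real.Gamma α * ((1 / (θ⁻¹ + s)) ^ α * Real.Gamma α) =
        θ⁻¹ ^ α * (1 / (θ⁻¹ + s)) ^ α := by field_simp
    rw [hc, ← Real.mul_rpow (by positivity) (by positivity),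
      Real.rpow_neg (by positivity), ← Real.inv_rpow (by positivity)]
    congr 1
    field_simp
  · refine (ae_restrict_iff' measurableSet_Ioi).2 (ae_of_all _ fun x hx => ?_)
    have : 0 < x := hx
    simp only [Pi.zero_apply]
    positivity

/-- On `(0, ∞)` the power `y ^ (α - 1)` with `α ≤ 1` is a mixture of decaying exponentials. -/
lemma exists_lintegral_exp_eq_rpow {α : ℝ} (hα : α ≤ 1) :
    ∃ m : Measure ℝ, SFinite m ∧ (∀ᵐ t ∂m, 0 ≤ t) ∧ ∀ y : ℝ, 0 < y →
      ENNReal.ofReal (y ^ (α - 1)) = ∫⁻ t, ENNReal.ofReal (Real.exp (-(t * y))) ∂m := by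
  rcases hα.eq_or_lt with rfl | hlt
  -- At `α = 1` the power is constant and the mixing measure is a point mass; for `α < 1` it has
  -- density `t ^ (-α) / Γ(1 - α)`, by Euler's integral.
  · refine ⟨Measure.dirac 0, inferInstance, ?_, fun y _ => ?_⟩
    · rw [ae_dirac_iff measurableSet_Ici]
    · rw [lintegral_dirac' _ (by fun_prop)]
      simp
  · have ha : 0 < 1 - α := by linarith
    have hΓ := Real.Gamma_pos_of_pos ha
    have hmeas : Measurable fun t : ℝ =>
        ENNReal.ofReal (t ^ (1 - α - 1) / Real.Gamma (1 - α)) := by fun_prop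
    refine ⟨(volume.restrict (Set.Ioi 0)).withDensity
      fun t => ENNReal.ofReal (t ^ (1 - α - 1) / Real.Gamma (1 - α)), inferInstance, ?_,
      fun y hy => ?_⟩
    · refine (withDensity_absolutelyContinuous _ _).ae_le ?_
      exact (ae_restrict_iff' measurableSet_Ioi).2 (ae_of_all _ fun t ht => le_of_lt ht)
    · have hI := Real.integral_rpow_mul_exp_neg_mul_Ioi ha hy
      have hint : IntegrableOn (fun t : ℝ => t ^ (1 - α - 1) * Real.exp (-(y * t)))
          (Set.Ioi 0) := by
        refine Integrable.of_integral_ne_zero ?_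
        rw [hI]
        positivity
      have h1 : ∀ t : ℝ, ((fun t => ENNReal.ofReal (t ^ (1 - α - 1) / Real.Gamma (1 - α))) *
          fun t => ENNReal.ofReal (Real.exp (-(t * y)))) t =
          ENNReal.ofReal ((Real.Gamma (1 - α))⁻¹ *
            (t ^ (1 - α - 1) * Real.exp (-(y * t)))) := by
        intro t
        rw [Pi.mul_apply, ← ENNReal.ofReal_mul' (Real.exp_pos _).le]
        congr 1
        ring_nf
      rw [lintegral_withDensity_eq_lintegral_mul _ hmeas (by fun_prop)]
      simp_rw [h1]
      rw [← ofReal_integral_eq_lintegral_ofReal (hint.const_mul _), integral_const_mul, hI]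
      · congr 1
        rw [mul_comm, mul_assoc, mul_inv_cancel₀ hΓ.ne', mul_one, one_div,
          Real.inv_rpow hy.le, ← Real.rpow_neg hy.le]
        congr 1
        ring
      · refine (ae_restrict_iff' measurableSet_Ioi).2 (ae_of_all _ fun t ht => ?_)
        have : 0 < t := ht
        simp only [Pi.zero_apply]
        positivity

lemma lintegral_Ioi_exp_neg_mul {a : ℝ} (ha : 0 < a) (x : ℝ) :
    ∫⁻ y in Set.Ioi x, ENNReal.ofReal (Real.exp (-(a * y)))
      = ENNReal.ofReal (Real.exp (-(a * x)) / a) := by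
  have hint := integrableOn_exp_mul_Ioi (a := -a) (by linarith) x
  have hI := integral_exp_mul_Ioi (a := -a) (by linarith) x
  simp only [neg_mul] at hint hI
  rw [← ofReal_integral_eq_lintegral_ofReal hint (ae_of_all _ fun y => (Real.exp_pos _).le), hI,
    neg_div_neg_eq]

/-- The tail of a gamma law with shape at most one is a mixture of decaying exponentials. -/
lemma exists_gammaLaw_Ioi_eq_lintegral_exp {α θ : ℝ} (hα0 : 0 < α) (hα : α ≤ 1) (hθ : 0 < θ) :
    ∃ (m : Measure ℝ) (w : ℝ → ENNReal), SFinite m ∧ Measurable w ∧ (∀ᵐ t ∂m, 0 ≤ t) ∧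
      ∀ x : ℝ, 0 ≤ x → gammaLaw α θ (Set.Ioi x) =
        ∫⁻ t, w t * ENNReal.ofReal (Real.exp (-((θ⁻¹ + t) * x))) ∂m := by
  obtain ⟨m, hm, hm0, h⟩ := exists_lintegral_exp_eq_rpow hα
  have hk : 0 < θ⁻¹ := inv_pos.2 hθ
  have hΓ := Real.Gamma_pos_of_pos hα0
  set K : ℝ := θ⁻¹ ^ α / Real.Gamma α with hK
  have hK0 : 0 < K := by positivity
  -- The weight comes from integrating `K exp (-(θ⁻¹ + t) y)` over `y > x`.
  refine ⟨m, fun t => ENNReal.ofReal (K / (θ⁻¹ + t)), hm, by fun_prop, hm0, fun x hx => ?_⟩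
  rw [gammaLaw_eq_withDensity, withDensity_apply _ measurableSet_Ioi]
  have h1 : ∀ y ∈ Set.Ioi x, gammaPDF α θ⁻¹ y =
      ∫⁻ t, ENNReal.ofReal K * ENNReal.ofReal (Real.exp (-((θ⁻¹ + t) * y))) ∂m := by
    intro y hy
    have hy0 : 0 < y := lt_of_le_of_lt hx hy
    rw [gammaPDF_of_nonneg hy0.le, lintegral_const_mul _ (by fun_prop), mul_assoc,
      ENNReal.ofReal_mul hK0.le, ENNReal.ofReal_mul (by positivity), h y hy0,
      mul_comm (∫⁻ t, _ ∂m), ← lintegral_const_mul _ (by fun_prop)]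
    congr 1
    refine lintegral_congr fun t => ?_
    rw [← ENNReal.ofReal_mul (Real.exp_pos _).le, ← Real.exp_add]
    ring_nf
  rw [setLIntegral_congr_fun measurableSet_Ioi h1, lintegral_lintegral_swap (by fun_prop)]
  refine lintegral_congr_ae ?_
  filter_upwards [hm0] with t ht
  have hkt : 0 < θ⁻¹ + t := by linarith
  rw [lintegral_const_mul _ (by fun_prop), lintegral_Ioi_exp_neg_mul hkt,
    ← ENNReal.ofReal_mul hK0.le, ← ENNReal.ofReal_mul (by positivity)]
  congr 1
  ring

/-! ### Ratio tails and Laplace transforms of the denominator. -/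

section Ratio

variable {Ω : Type*} [MeasurableSpace Ω] {μ : Measure Ω} [SFinite μ] {I : Ω → ℝ}

lemma measurableSet_lt_div (hI : Measurable I) (c : ℝ) :
    MeasurableSet {x : ℝ × Ω | c < x.1 / I x.2} :=
  measurableSet_lt measurable_const (measurable_fst.div (hI.comp measurable_snd))

/-- Only an inequality, because `g / 0 = 0` removes the points with `I = 0` from the event. This
suffices on the smaller side of the comparison, so positivity of `I` need not be known there. -/
lemma prod_setOf_lt_div_le (G : Measure ℝ) [SFinite G] (hI : Measurable I)
    (hI0 : ∀ᵐ ω ∂μ, 0 ≤ I ω) {c : ℝ} (hc : 0 < c) :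
    (G.prod μ) {x | c < x.1 / I x.2} ≤ ∫⁻ ω, G (Set.Ioi (c * I ω)) ∂μ := by
  rw [Measure.prod_apply_symm (measurableSet_lt_div hI c)]
  refine lintegral_mono_ae ?_
  filter_upwards [hI0] with ω hω
  refine measure_mono fun g hg => ?_
  have hg : c < g / I ω := hg
  rcases hω.eq_or_lt with h0 | h0
  · rw [← h0, div_zero] at hg
    linarith
  · exact (lt_div_iff₀ h0).1 hg

lemma prod_setOf_lt_div (G : Measure ℝ) [SFinite G] (hI : Measurable I)
    (hI0 : ∀ᵐ ω ∂μ, 0 < I ω) (c : ℝ) :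
    (G.prod μ) {x | c < x.1 / I x.2} = ∫⁻ ω, G (Set.Ioi (c * I ω)) ∂μ := by
  rw [Measure.prod_apply_symm (measurableSet_lt_div hI c)]
  refine lintegral_congr_ae ?_
  filter_upwards [hI0] with ω hω
  congr 1
  ext g
  exact lt_div_iff₀ hω

/-- Tonelli: averaging a mixture of exponentials over `I` yields the same mixture of Laplace
transform values. -/
lemma lintegral_exp_mixture {m : Measure ℝ} [SFinite m] {w F : ℝ → ENNReal} (hw : Measurable w)
    {k : ℝ} (hF : ∀ x : ℝ, 0 ≤ x →
      F x = ∫⁻ t, w t * ENNReal.ofReal (Real.exp (-((k + t) * x))) ∂m)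
    (hI : Measurable I) (hI0 : ∀ᵐ ω ∂μ, 0 ≤ I ω) {c : ℝ} (hc : 0 < c) :
    ∫⁻ ω, F (c * I ω) ∂μ =
      ∫⁻ t, w t * ∫⁻ ω, ENNReal.ofReal (Real.exp (-(((k + t) * c) * I ω))) ∂μ ∂m := by
  rw [lintegral_congr_ae (g := fun ω =>
    ∫⁻ t, w t * ENNReal.ofReal (Real.exp (-((k + t) * (c * I ω)))) ∂m)]
  · rw [lintegral_lintegral_swap (by fun_prop)]
    refine lintegral_congr fun t => ?_
    rw [lintegral_const_mul _ (by fun_prop)]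
    simp_rw [mul_assoc]
  · filter_upwards [hI0] with ω hω using hF _ (by positivity)

/-- With a gamma law of shape at most one in the numerator, the tail of the ratio is monotone in
the Laplace transform of the denominator. -/
lemma prod_gammaLaw_setOf_lt_div_le {Ω' : Type*} [MeasurableSpace Ω'] {μ' : Measure Ω'} [SFinite μ']
    {I' : Ω' → ℝ} {α θ : ℝ} (hα0 : 0 < α) (hα : α ≤ 1) (hθ : 0 < θ)
    (hI : Measurable I) (hI0 : ∀ᵐ ω ∂μ, 0 ≤ I ω) (hI' : Measurable I')
    (hI0' : ∀ᵐ ω ∂μ', 0 < I' ω)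
    (hL : ∀ s, 0 ≤ s → ∫⁻ ω, ENNReal.ofReal (Real.exp (-(s * I ω))) ∂μ ≤
      ∫⁻ ω, ENNReal.ofReal (Real.exp (-(s * I' ω))) ∂μ') {c : ℝ} (hc : 0 < c) :
    ((gammaLaw α θ).prod μ) {x | c < x.1 / I x.2} ≤
      ((gammaLaw α θ).prod μ') {x | c < x.1 / I' x.2} := by
  have := isProbabilityMeasure_gammaLaw hα0 hθ
  obtain ⟨m, w, hm, hw, hm0, h⟩ := exists_gammaLaw_Ioi_eq_lintegral_exp hα0 hα hθ
  rw [prod_setOf_lt_div _ hI' hI0']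
  refine (prod_setOf_lt_div_le _ hI hI0 hc).trans ?_
  rw [lintegral_exp_mixture hw h hI hI0 hc,
    lintegral_exp_mixture hw h hI' (hI0'.mono fun _ h => h.le) hc]
  refine lintegral_mono_ae ?_
  filter_upwards [hm0] with t ht
  have : 0 < θ⁻¹ := inv_pos.2 hθ
  gcongr
  exact hL _ (by positivity)

end Ratio

lemma ae_pos_pi_gammaLaw {ι : Type*} [Fintype ι] {α : ℝ} {θ : ι → ℝ} (hα : 0 < α)
    (hθ : ∀ i, 0 < θ i) : ∀ᵐ x ∂Measure.pi fun i => gammaLaw α (θ i), ∀ i, 0 < x i := by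
  have := fun i => isProbabilityMeasure_gammaLaw hα (hθ i)
  rw [ae_all_iff]
  exact fun i => (Measure.quasiMeasurePreserving_eval (fun i => gammaLaw α (θ i)) i).ae
    (ae_pos_gammaLaw α (θ i))

/-- The Laplace transform of a weighted sum of independent gamma variables. -/
lemma lintegral_exp_pi_gammaLaw {ι : Type*} [Fintype ι] {α : ℝ} {θ w : ι → ℝ} (hα : 0 < α)
    (hθ : ∀ i, 0 < θ i) (hw : ∀ i, 0 ≤ w i) :
    ∫⁻ x, ENNReal.ofReal (Real.exp (-∑ i, w i * x i)) ∂Measure.pi (fun i => gammaLaw α (θ i)) =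
      ENNReal.ofReal ((∏ i, (1 + w i * θ i)) ^ (-α)) := by
  have := fun i => isProbabilityMeasure_gammaLaw hα (hθ i)
  have hpos : ∀ i, 0 < 1 + w i * θ i := fun i =>
    add_pos_of_pos_of_nonneg one_pos (mul_nonneg (hw i) (hθ i).le)
  have h1 : ∀ i, ∫ x, Real.exp (-(w i * x)) ∂gammaLaw α (θ i) = (1 + w i * θ i) ^ (-α) := by
    intro i
    rw [integral_eq_lintegral_of_nonneg_ae (ae_of_all _ fun x => (Real.exp_pos _).le)
      (by fun_prop), lintegral_exp_gammaLaw hα (hθ i) (hw i),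
      ENNReal.toReal_ofReal (Real.rpow_nonneg (hpos i).le _)]
  have h2 : ∫ x, Real.exp (-∑ i, w i * x i) ∂Measure.pi (fun i => gammaLaw α (θ i)) =
      (∏ i, (1 + w i * θ i)) ^ (-α) := by
    rw [← Real.finsetProd_rpow _ _ fun i _ => (hpos i).le]
    simp_rw [← h1]
    rw [← integral_fintype_prod_eq_prod (𝕜 := ℝ) (fun i x => Real.exp (-(w i * x)))]
    simp_rw [← Real.exp_sum, Finset.sum_neg_distrib]
  have h3 : Integrable (fun x : ι → ℝ => Real.exp (-∑ i, w i * x i))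
      (Measure.pi fun i => gammaLaw α (θ i)) := by
    refine Integrable.of_integral_ne_zero ?_
    rw [h2]
    exact (Real.rpow_pos_of_pos (Finset.prod_pos fun i _ => hpos i) _).ne'
  rw [← ofReal_integral_eq_lintegral_ofReal h3 (ae_of_all _ fun x => (Real.exp_pos _).le), h2]

/-- Where `I ≤ 0` the integrand is at least `1`, so by Markov's inequality the mass of this set is
below a bound that tends to `0` as `s → ∞`. -/
lemma ae_pos_of_lintegral_exp_le {Ω : Type*} [MeasurableSpace Ω] {μ : Measure Ω} {I : Ω → ℝ}
    {e α : ℝ} (he : 0 < e) (hα : 0 < α) (hI : AEMeasurable I μ) (hL : ∀ s, 0 ≤ s →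
      ∫⁻ ω, ENNReal.ofReal (Real.exp (-(s * I ω))) ∂μ ≤
        ENNReal.ofReal ((1 + s * e) ^ (-α))) : ∀ᵐ ω ∂μ, 0 < I ω := by
  rw [ae_iff]
  have hlim : Filter.Tendsto (fun s : ℝ => ENNReal.ofReal ((1 + s * e) ^ (-α)))
      Filter.atTop (nhds 0) := by
    rw [← ENNReal.ofReal_zero]
    refine ENNReal.tendsto_ofReal ((tendsto_rpow_neg_atTop hα).comp ?_)
    exact Filter.tendsto_atTop_add_const_left _ _ (Filter.tendsto_id.atTop_mul_const he)
  refine le_antisymm (ge_of_tendsto hlim ?_) zero_le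
  filter_upwards [Filter.eventually_ge_atTop 0] with s hs
  refine le_trans ?_ (hL s hs)
  have hsub : {ω | ¬ 0 < I ω} ⊆ {ω | 1 ≤ ENNReal.ofReal (Real.exp (-(s * I ω)))} := by
    intro ω hω
    have hω : I ω ≤ 0 := not_lt.1 hω
    refine ENNReal.one_le_ofReal.2 (Real.one_le_exp ?_)
    nlinarith
  calc μ {ω | ¬ 0 < I ω} ≤ μ {ω | 1 ≤ ENNReal.ofReal (Real.exp (-(s * I ω)))} :=
        measure_mono hsub
    _ ≤ ∫⁻ ω, ENNReal.ofReal (Real.exp (-(s * I ω))) ∂μ := by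
        simpa using mul_meas_ge_le_lintegral₀ (μ := μ)
          (f := fun ω => ENNReal.ofReal (Real.exp (-(s * I ω)))) (by fun_prop) 1

/-! ### Coverage for user shape at most one. -/

namespace Network

variable {N : ℕ} (n : Network N)

/-- The total interference, with the transmit power divided out. -/
noncomputable def interference (h : Fin N → ℝ) : ℝ := ∑ i, h i * n.d i ^ (-n.β)

@[fun_prop]
lemma measurable_interference : Measurable n.interference := by
  unfold interference
  fun_prop

lemma sum_mul_eq_interference (s : ℝ) (h : Fin N → ℝ) :
    ∑ i, s * n.d i ^ (-n.β) * h i = s * n.interference h := by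
  rw [interference, Finset.mul_sum]
  exact Finset.sum_congr rfl fun i _ => by ring

lemma lt_sir_iff {T g : ℝ} {h : Fin N → ℝ} :
    T < n.sir g h ↔ T / n.r ^ (-n.β) < g / n.interference h := by
  have hR : 0 < n.r ^ (-n.β) := Real.rpow_pos_of_pos n.r_pos _
  have : n.sir g h = g / n.interference h * n.r ^ (-n.β) := by
    have h1 : ∑ i, n.power * h i * n.d i ^ (-n.β) = n.power * n.interference h := by
      simp_rw [interference, Finset.mul_sum, mul_assoc]
    rw [sir, h1, mul_assoc, mul_div_mul_left _ _ n.power_pos.ne']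
    ring
  rw [this, div_lt_iff₀ hR]

lemma coverage_eq (ν : Measure (Fin N → ℝ)) (T : ℝ) :
    n.coverage ν T =
      ((gammaLaw n.αu n.θu).prod ν).real {x | T / n.r ^ (-n.β) < x.1 / n.interference x.2} := by
  simp_rw [coverage, lt_sir_iff]

lemma coverageOfScales_eq (μ : Fin N → ℝ) (T : ℝ) :
    n.coverageOfScales μ T =
      ((gammaLaw n.αu n.θu).prod (Measure.pi fun _ : Fin N => gammaLaw n.αc 1)).real
        {x | T / n.r ^ (-n.β) < x.1 / ∑ i, μ i * x.2 i} := by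
  have hR : 0 < n.r ^ (-n.β) := Real.rpow_pos_of_pos n.r_pos _
  simp_rw [coverageOfScales, div_lt_iff₀ hR, div_mul_eq_mul_div]

lemma receivedScale_pos (i : Fin N) : 0 < n.receivedScale i :=
  mul_pos (n.θ_pos i) (Real.rpow_pos_of_pos (n.d_pos i) _)

lemma exists_charpoly_matrixA {ρ : Fin N → Fin N → ℝ} (hρ : IsCorrelation ρ) :
    ∃ e : Fin N → ℝ, (∀ i, 0 < e i) ∧
      (n.matrixA ρ).charpoly = ∏ i, (Polynomial.X - Polynomial.C (e i)) :=
  hρ.posDef.exists_charpoly_diagonal_mul n.receivedScale_pos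

lemma lintegral_exp_interference_indepLaw {s : ℝ} (hs : 0 ≤ s) :
    ∫⁻ h, ENNReal.ofReal (Real.exp (-(s * n.interference h))) ∂n.indepLaw =
      ENNReal.ofReal ((∏ i, (1 + s * n.receivedScale i)) ^ (-n.αc)) := by
  have h := lintegral_exp_pi_gammaLaw (w := fun i => s * n.d i ^ (-n.β)) n.αc_pos n.θ_pos
    fun i => mul_nonneg hs (Real.rpow_nonneg (n.d_pos i).le _)
  have h2 : ∀ i, 1 + s * n.d i ^ (-n.β) * n.θ i = 1 + s * n.receivedScale i := by
    intro i
    rw [receivedScale]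
    ring
  simp only [sum_mul_eq_interference, h2] at h
  exact h

lemma ae_interference_nonneg_indepLaw : ∀ᵐ h ∂n.indepLaw, 0 ≤ n.interference h := by
  filter_upwards [ae_pos_pi_gammaLaw n.αc_pos n.θ_pos] with h hh
  exact Finset.sum_nonneg fun i _ =>
    mul_nonneg (hh i).le (Real.rpow_nonneg (n.d_pos i).le _)

/-- The joint transform is evaluated at `sᵢ = s dᵢ ^ (-β)`, which turns `diag(s) diag(θ) C` into `s
A`. -/
lemma lintegral_exp_interference_of_isCorrelatedLaw {ρ : Fin N → Fin N → ℝ}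
    (hρ : IsCorrelation ρ) {ν : Measure (Fin N → ℝ)} (hν : n.IsCorrelatedLaw ρ ν) {s : ℝ}
    (hs : 0 ≤ s) :
    ∫⁻ h, ENNReal.ofReal (Real.exp (-(s * n.interference h))) ∂ν =
      ENNReal.ofReal ((1 + s • n.matrixA ρ).det ^ (-n.αc)) := by
  obtain ⟨e, he, hA⟩ := n.exists_charpoly_matrixA hρ
  have hpos : 0 < (1 + s • n.matrixA ρ).det := by
    rw [Matrix.det_one_add_smul_eq_prod hA]
    exact Finset.prod_pos fun i _ => add_pos_of_pos_of_nonneg one_pos (mul_nonneg hs (he i).le)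
  have h := hν.laplace (fun i => s * n.d i ^ (-n.β))
    fun i => mul_nonneg hs (Real.rpow_nonneg (n.d_pos i).le _)
  have hm : Matrix.diagonal (fun i => s * n.d i ^ (-n.β)) * (Matrix.diagonal n.θ * corrMatrix ρ) =
      s • n.matrixA ρ := by
    ext i j
    simp only [matrixA, Matrix.diagonal_mul, Matrix.smul_apply, receivedScale, smul_eq_mul]
    ring
  rw [hm] at h
  simp_rw [sum_mul_eq_interference] at h
  rw [← ofReal_integral_eq_lintegral_ofReal (Integrable.of_integral_ne_zero _)
    (ae_of_all _ fun x => (Real.exp_pos _).le), h]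
  rw [h]
  exact (Real.rpow_pos_of_pos hpos _).ne'

lemma corrMatrix_apply_self (ρ : Fin N → Fin N → ℝ) (i : Fin N) : corrMatrix ρ i i = 1 := by
  simp [corrMatrix]

lemma prod_rpow_le_det_rpow {ρ : Fin N → Fin N → ℝ} (hρ : IsCorrelation ρ) {s : ℝ} (hs : 0 ≤ s) :
    (∏ i, (1 + s * n.receivedScale i)) ^ (-n.αc) ≤ (1 + s • n.matrixA ρ).det ^ (-n.αc) := by
  obtain ⟨e, he, hA⟩ := n.exists_charpoly_matrixA hρ
  refine Real.rpow_le_rpow_of_nonpos ?_ (hρ.posDef.det_one_add_smul_diagonal_mul_le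
    (corrMatrix_apply_self ρ) n.receivedScale_pos hs) (neg_nonpos.2 n.αc_pos.le)
  rw [Matrix.det_one_add_smul_eq_prod hA]
  exact Finset.prod_pos fun i _ => add_pos_of_pos_of_nonneg one_pos (mul_nonneg hs (he i).le)

/-- All factors `1 + s eᵢ` are at least `1`, so the determinant dominates a single one and the
transform vanishes as `s → ∞`. At least one interferer is needed. -/
lemma ae_interference_pos_of_isCorrelatedLaw [NeZero N] {ρ : Fin N → Fin N → ℝ}
    (hρ : IsCorrelation ρ) {ν : Measure (Fin N → ℝ)} (hν : n.IsCorrelatedLaw ρ ν) :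
    ∀ᵐ h ∂ν, 0 < n.interference h := by
  obtain ⟨e, he, hA⟩ := n.exists_charpoly_matrixA hρ
  refine ae_pos_of_lintegral_exp_le (he 0) n.αc_pos (n.measurable_interference).aemeasurable
    fun s hs => ?_
  rw [n.lintegral_exp_interference_of_isCorrelatedLaw hρ hν hs,
    Matrix.det_one_add_smul_eq_prod hA]
  have h1 : ∀ i, 1 ≤ 1 + s * e i := fun i => le_add_of_nonneg_right (mul_nonneg hs (he i).le)
  refine ENNReal.ofReal_le_ofReal (Real.rpow_le_rpow_of_nonpos (by linarith [h1 0]) ?_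
    (neg_nonpos.2 n.αc_pos.le))
  calc 1 + s * e 0 = ∏ i, if i = 0 then 1 + s * e i else 1 := by simp
    _ ≤ ∏ i, (1 + s * e i) := by
        refine Finset.prod_le_prod (fun i _ => ?_) fun i _ => ?_ <;> split_ifs <;>
          linarith [h1 i]

/-- Correlation of the interferers increases the coverage if the user channel has shape at most
one. -/
theorem coverage_indepLaw_le_coverage {ρ : Fin N → Fin N → ℝ} (hαu : n.αu ≤ 1)
    (hρ : IsCorrelation ρ) {ν : Measure (Fin N → ℝ)} (hν : n.IsCorrelatedLaw ρ ν) {T : ℝ}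
    (hT : 0 < T) : n.coverage n.indepLaw T ≤ n.coverage ν T := by
  -- Without interferers the ratio is `g / 0 = 0`, so both coverages vanish.
  rcases N.eq_zero_or_pos with rfl | hN
  · simp [coverage_eq, interference, (div_pos hT (Real.rpow_pos_of_pos n.r_pos (-n.β))).not_gt]
  have : NeZero N := ⟨hN.ne'⟩
  have := hν.isProbabilityMeasure
  have := isProbabilityMeasure_gammaLaw n.αu_pos n.θu_pos
  have := fun i => isProbabilityMeasure_gammaLaw n.αc_pos (n.θ_pos i)
  have : IsProbabilityMeasure n.indepLaw := by unfold indepLaw; infer_instance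
  rw [coverage_eq, coverage_eq]
  refine ENNReal.toReal_mono (measure_ne_top _ _) ?_
  refine prod_gammaLaw_setOf_lt_div_le n.αu_pos hαu n.θu_pos n.measurable_interference
    n.ae_interference_nonneg_indepLaw n.measurable_interference
    (n.ae_interference_pos_of_isCorrelatedLaw hρ hν) (fun s hs => ?_)
    (div_pos hT (Real.rpow_pos_of_pos n.r_pos _))
  rw [n.lintegral_exp_interference_indepLaw hs,
    n.lintegral_exp_interference_of_isCorrelatedLaw hρ hν hs]
  exact ENNReal.ofReal_le_ofReal (n.prod_rpow_le_det_rpow hρ hs)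

/-- The weighted sum whose scales are the eigenvalues of `A` gives a larger coverage than the
independent interferers if the user channel has shape at most one. -/
theorem coverage_indepLaw_le_coverageOfScales {ρ : Fin N → Fin N → ℝ} (hαu : n.αu ≤ 1)
    (hρ : IsCorrelation ρ) {μ : Fin N → ℝ}
    (hμ : (n.matrixA ρ).charpoly = ∏ i, (Polynomial.X - Polynomial.C (μ i))) {T : ℝ}
    (hT : 0 < T) : n.coverage n.indepLaw T ≤ n.coverageOfScales μ T := by
  rcases N.eq_zero_or_pos with rfl | hN
  · simp [coverage_eq, coverageOfScales_eq, interference,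
      (div_pos hT (Real.rpow_pos_of_pos n.r_pos (-n.β))).not_gt]
  have : NeZero N := ⟨hN.ne'⟩
  have hμ0 : ∀ i, 0 < μ i := hρ.posDef.pos_of_charpoly_diagonal_mul n.receivedScale_pos hμ
  have := isProbabilityMeasure_gammaLaw n.αu_pos n.θu_pos
  have := isProbabilityMeasure_gammaLaw n.αc_pos one_pos
  have := fun i => isProbabilityMeasure_gammaLaw n.αc_pos (n.θ_pos i)
  have : IsProbabilityMeasure n.indepLaw := by unfold indepLaw; infer_instance
  rw [coverage_eq, coverageOfScales_eq]
  refine ENNReal.toReal_mono (measure_ne_top _ _) ?_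
  refine prod_gammaLaw_setOf_lt_div_le (I' := fun x : Fin N → ℝ => ∑ i, μ i * x i)
    n.αu_pos hαu n.θu_pos n.measurable_interference
    n.ae_interference_nonneg_indepLaw (by fun_prop) ?_ (fun s hs => ?_)
    (div_pos hT (Real.rpow_pos_of_pos n.r_pos _))
  · filter_upwards [ae_pos_pi_gammaLaw n.αc_pos fun _ : Fin N => one_pos] with x hx
    exact Finset.sum_pos (fun i _ => mul_pos (hμ0 i) (hx i)) Finset.univ_nonempty
  · have h := lintegral_exp_pi_gammaLaw (w := fun i => s * μ i) n.αc_pos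
      (fun _ : Fin N => one_pos) fun i => mul_nonneg hs (hμ0 i).le
    simp only [mul_one, mul_assoc, ← Finset.mul_sum] at h
    rw [n.lintegral_exp_interference_indepLaw hs, h, ← Matrix.det_one_add_smul_eq_prod hμ]
    exact ENNReal.ofReal_le_ofReal (n.prod_rpow_le_det_rpow hρ hs)

end Network

/-! ### Gamma distribution function near zero, and gamma moments. -/

lemma cdf_gammaLaw_one_eq {p x : ℝ} (hp : 0 < p) (hx : 0 ≤ x) :
    cdf (gammaLaw p 1) x = (Real.Gamma p)⁻¹ * ∫ y in 0..x, y ^ (p - 1) * Real.exp (-y) := by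
  rw [gammaLaw, inv_one, cdf_gammaMeasure_eq_integral hp one_pos,
    setIntegral_eq_of_subset_of_forall_sdiff_eq_zero (s := Set.Icc 0 x) measurableSet_Iic
      (fun y hy => hy.2) (fun y hy => ?_),
    integral_Icc_eq_integral_Ioc, intervalIntegral.integral_of_le hx, ← integral_const_mul]
  · refine setIntegral_congr_fun measurableSet_Ioc fun y hy => ?_
    simp [gammaPDFReal, hy.1.le, mul_assoc]
  · have : ¬ 0 ≤ y := fun h => hy.2 ⟨h, hy.1⟩
    simp [gammaPDFReal, this]

lemma intervalIntegrable_rpow_sub_one {p : ℝ} (hp : 0 < p) (x : ℝ) :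
    IntervalIntegrable (fun y : ℝ => y ^ (p - 1)) volume 0 x :=
  intervalIntegral.intervalIntegrable_rpow' (by linarith)

lemma integral_rpow_sub_one {p : ℝ} (hp : 0 < p) (x : ℝ) :
    ∫ y in (0 : ℝ)..x, y ^ (p - 1) = p⁻¹ * x ^ p := by
  rw [integral_rpow (Or.inl (by linarith)), sub_add_cancel, Real.zero_rpow hp.ne']
  ring

/-- Drop the factor `exp (-y) ≤ 1` from the density. Together with the lower bound using `exp (-y) ≥
exp (-x)`, this gives the leading term `x ^ p / (Γ(p) p)` at `0`. -/
lemma cdf_gammaLaw_one_le {p x : ℝ} (hp : 0 < p) (hx : 0 ≤ x) :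
    cdf (gammaLaw p 1) x ≤ (Real.Gamma p * p)⁻¹ * x ^ p := by
  have hΓ := Real.Gamma_pos_of_pos hp
  rw [cdf_gammaLaw_one_eq hp hx, mul_inv, mul_assoc, ← integral_rpow_sub_one hp]
  gcongr
  refine intervalIntegral.integral_mono_on hx
    ((intervalIntegrable_rpow_sub_one hp x).mul_continuousOn (by fun_prop))
    (intervalIntegrable_rpow_sub_one hp x) fun y hy => ?_
  exact mul_le_of_le_one_right (Real.rpow_nonneg hy.1 _)
    (Real.exp_le_one_iff.2 (neg_nonpos.2 hy.1))

lemma le_cdf_gammaLaw_one {p x : ℝ} (hp : 0 < p) (hx : 0 ≤ x) :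
    (Real.Gamma p * p)⁻¹ * (Real.exp (-x) * x ^ p) ≤ cdf (gammaLaw p 1) x := by
  have hΓ := Real.Gamma_pos_of_pos hp
  have h : (Real.Gamma p * p)⁻¹ * (Real.exp (-x) * x ^ p) =
      (Real.Gamma p)⁻¹ * ∫ y in (0 : ℝ)..x, y ^ (p - 1) * Real.exp (-x) := by
    rw [intervalIntegral.integral_mul_const, integral_rpow_sub_one hp]
    ring
  rw [h, cdf_gammaLaw_one_eq hp hx]
  gcongr
  refine intervalIntegral.integral_mono_on hx
    ((intervalIntegrable_rpow_sub_one hp x).mul_continuousOn (by fun_prop))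
    ((intervalIntegrable_rpow_sub_one hp x).mul_continuousOn (by fun_prop)) fun y hy => ?_
  exact mul_le_mul_of_nonneg_left (Real.exp_le_exp.2 (neg_le_neg hy.2)) (Real.rpow_nonneg hy.1 _)

/-- The gamma law has moments of all nonnegative orders. -/
lemma integrable_rpow_gammaLaw {α θ q : ℝ} (hα : 0 < α) (hθ : 0 < θ) (hq : 0 ≤ q) :
    Integrable (fun x => x ^ q) (gammaLaw α θ) := by
  have hk : 0 < θ⁻¹ := inv_pos.2 hθ
  have hΓ := Real.Gamma_pos_of_pos hα
  have hI := Real.integral_rpow_mul_exp_neg_mul_Ioi (a := α + q) (by linarith) hk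
  have hΓ' := Real.Gamma_pos_of_pos (s := α + q) (by linarith)
  have hint : IntegrableOn (fun x : ℝ => x ^ (α + q - 1) * Real.exp (-(θ⁻¹ * x)))
      (Set.Ioi 0) := by
    refine Integrable.of_integral_ne_zero ?_
    rw [hI]
    positivity
  refine ⟨by fun_prop, ?_⟩
  rw [hasFiniteIntegral_iff_ofReal]
  · rw [lintegral_gammaLaw (by fun_prop), setLIntegral_congr_fun (g := fun x => ENNReal.ofReal
      (θ⁻¹ ^ α / Real.Gamma α * (x ^ (α + q - 1) * Real.exp (-(θ⁻¹ * x))))) measurableSet_Ioi]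
    · exact (hasFiniteIntegral_iff_ofReal ((ae_restrict_iff' measurableSet_Ioi).2
        (ae_of_all _ fun x (hx : 0 < x) => by simp only [Pi.zero_apply]; positivity))).1
          (hint.const_mul _).2
    · intro x (hx : 0 < x)
      simp only
      rw [← ENNReal.ofReal_mul' (by positivity), show α + q - 1 = (α - 1) + q by ring,
        Real.rpow_add hx]
      ring_nf
  · filter_upwards [ae_pos_gammaLaw α θ] with x hx
    exact Real.rpow_nonneg hx.le _

/-! ### Comparison of ratio tails at small and large thresholds. -/

section Ratio

variable {Ω Ω' : Type*} [MeasurableSpace Ω] [MeasurableSpace Ω'] {μ : Measure Ω} {μ' : Measure Ω'}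
  [IsProbabilityMeasure μ] [IsProbabilityMeasure μ'] {I : Ω → ℝ} {I' : Ω' → ℝ}

lemma integrable_cdf_comp (G : Measure ℝ) [IsProbabilityMeasure G] (hI : Measurable I) (c : ℝ) :
    Integrable (fun ω => cdf G (c * I ω)) μ := by
  refine Integrable.of_bound
    ((monotone_cdf G).measurable.comp (hI.const_mul c)).aestronglyMeasurable 1
    (ae_of_all _ fun ω => ?_)
  rw [Real.norm_of_nonneg (cdf_nonneg _ _)]
  exact cdf_le_one _ _

lemma prod_real_setOf_lt_div (G : Measure ℝ) [IsProbabilityMeasure G] (hI : Measurable I)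
    (hI0 : ∀ᵐ ω ∂μ, 0 < I ω) (c : ℝ) :
    (G.prod μ).real {x | c < x.1 / I x.2} = 1 - ∫ ω, cdf G (c * I ω) ∂μ := by
  have hint := integrable_cdf_comp (μ := μ) G hI c
  have h1 : ∀ x, G (Set.Ioi x) = ENNReal.ofReal (1 - cdf G x) := by
    intro x
    rw [cdf_eq_real, ← probReal_compl_eq_one_sub measurableSet_Iic, Set.compl_Iic, ofReal_measureReal]
  have h2 : 1 - ∫ ω, cdf G (c * I ω) ∂μ = ∫ ω, (1 - cdf G (c * I ω)) ∂μ := by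
    rw [integral_sub (integrable_const _) hint]
    simp
  rw [measureReal_def, prod_setOf_lt_div G hI hI0, h2, integral_eq_lintegral_of_nonneg_ae
    (ae_of_all _ fun ω => sub_nonneg.2 (cdf_le_one _ _))
    ((integrable_const _).sub hint).aestronglyMeasurable]
  simp_rw [h1]

/-- For small thresholds the ratio with the larger moment of order `p` in the denominator has the
smaller tail. -/
lemma exists_prod_gammaLaw_lt_of_integral_rpow_lt {p : ℝ} (hp : 0 < p) (hI : Measurable I)
    (hI0 : ∀ᵐ ω ∂μ, 0 < I ω) (hI' : Measurable I') (hI0' : ∀ᵐ ω ∂μ', 0 < I' ω)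
    (hint : Integrable (fun ω => I ω ^ p) μ) (hint' : Integrable (fun ω => I' ω ^ p) μ')
    (hlt : ∫ ω, I ω ^ p ∂μ < ∫ ω, I' ω ^ p ∂μ') :
    ∃ c : ℝ, 0 < c ∧ ((gammaLaw p 1).prod μ').real {x | c < x.1 / I' x.2} <
      ((gammaLaw p 1).prod μ).real {x | c < x.1 / I x.2} := by
  have := isProbabilityMeasure_gammaLaw hp one_pos
  have hΓ := Real.Gamma_pos_of_pos hp
  -- The lower bound for the distribution function costs a factor `exp (-c I')`; dominated
  -- convergence removes it as `c → 0`, so the strict moment inequality survives at some `c > 0`.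
  have hlim : Filter.Tendsto (fun c : ℝ => ∫ ω, Real.exp (-(c * I' ω)) * I' ω ^ p ∂μ')
      (nhdsWithin 0 (Set.Ioi 0)) (nhds (∫ ω, I' ω ^ p ∂μ')) := by
    refine tendsto_integral_filter_of_dominated_convergence (fun ω => I' ω ^ p)
      (Filter.Eventually.of_forall fun c => by fun_prop) ?_ hint' (ae_of_all _ fun ω => ?_)
    · filter_upwards [self_mem_nhdsWithin] with c (hc : 0 < c)
      filter_upwards [hI0'] with ω hω
      rw [Real.norm_of_nonneg (by positivity)]
      exact mul_le_of_le_one_left (by positivity)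
        (Real.exp_le_one_iff.2 (neg_nonpos.2 (by positivity)))
    · have : Continuous fun c : ℝ => Real.exp (-(c * I' ω)) * I' ω ^ p := by fun_prop
      have := this.tendsto 0
      simp only [zero_mul, neg_zero, Real.exp_zero, one_mul] at this
      exact this.mono_left nhdsWithin_le_nhds
  obtain ⟨c, hc, hc0⟩ := ((hlim.eventually_const_lt hlt).and self_mem_nhdsWithin).exists
  have hc0 : 0 < c := hc0
  refine ⟨c, hc0, ?_⟩
  rw [prod_real_setOf_lt_div _ hI hI0, prod_real_setOf_lt_div _ hI' hI0', sub_lt_sub_iff_left]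
  have hint2 : Integrable (fun ω => Real.exp (-(c * I' ω)) * I' ω ^ p) μ' := by
    refine hint'.mono' (by fun_prop) ?_
    filter_upwards [hI0'] with ω hω
    rw [Real.norm_of_nonneg (by positivity)]
    exact mul_le_of_le_one_left (by positivity)
      (Real.exp_le_one_iff.2 (neg_nonpos.2 (by positivity)))
  calc ∫ ω, cdf (gammaLaw p 1) (c * I ω) ∂μ
      ≤ ∫ ω, (Real.Gamma p * p)⁻¹ * c ^ p * I ω ^ p ∂μ := by
        refine integral_mono_ae (integrable_cdf_comp _ hI c) (hint.const_mul _) ?_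
        filter_upwards [hI0] with ω hω
        rw [mul_assoc, ← Real.mul_rpow hc0.le hω.le]
        exact cdf_gammaLaw_one_le hp (by positivity)
    _ = (Real.Gamma p * p)⁻¹ * c ^ p * ∫ ω, I ω ^ p ∂μ := integral_const_mul _ _
    _ < (Real.Gamma p * p)⁻¹ * c ^ p * ∫ ω, Real.exp (-(c * I' ω)) * I' ω ^ p ∂μ' := by gcongr
    _ = ∫ ω, (Real.Gamma p * p)⁻¹ * c ^ p * (Real.exp (-(c * I' ω)) * I' ω ^ p) ∂μ' :=
        (integral_const_mul _ _).symm
    _ ≤ ∫ ω, cdf (gammaLaw p 1) (c * I' ω) ∂μ' := by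
        refine integral_mono_ae (hint2.const_mul _) (integrable_cdf_comp _ hI' c) ?_
        filter_upwards [hI0'] with ω hω
        refine le_trans (le_of_eq ?_) (le_cdf_gammaLaw_one hp (by positivity))
        rw [Real.mul_rpow hc0.le hω.le]
        ring

/-- Slicing over `g` instead of `I` exposes the distribution function of `I` near `0` when `c` is
large. -/
lemma prod_setOf_lt_div_eq_lintegral (G : Measure ℝ) [SFinite G] (hI : Measurable I)
    (hI0 : ∀ᵐ ω ∂μ, 0 < I ω) {c : ℝ} (hc : 0 < c) :
    (G.prod μ) {x | c < x.1 / I x.2} = ∫⁻ g, μ {ω | I ω < g / c} ∂G := by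
  rw [Measure.prod_apply (measurableSet_lt_div hI c)]
  refine lintegral_congr fun g => measure_congr ?_
  filter_upwards [hI0] with ω hω
  refine propext ?_
  change c < g / I ω ↔ I ω < g / c
  rw [lt_div_iff₀ hω, lt_div_iff₀ hc, mul_comm]

/-- For large thresholds the ratio whose denominator puts more mass near `0` has the larger
tail. -/
lemma exists_prod_lt_of_measure_lt_le {G : Measure ℝ} [IsProbabilityMeasure G]
    (hG0 : ∀ᵐ g ∂G, 0 < g) (hG : Integrable (fun g => g) G) (hI : Measurable I)
    (hI0 : ∀ᵐ ω ∂μ, 0 < I ω) (hI' : Measurable I') (hI0' : ∀ᵐ ω ∂μ', 0 < I' ω)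
    {a b k : ℝ} (ha : 0 ≤ a) (hab : a < b) (hk : 0 ≤ k)
    (hle : ∀ y, 0 < y → μ {ω | I ω < y} ≤ ENNReal.ofReal (a * y))
    (hge : ∀ y, 0 < y → ENNReal.ofReal (b * (y * Real.exp (-(k * y)))) ≤ μ' {ω | I' ω < y}) :
    ∃ c : ℝ, 0 < c ∧ (G.prod μ).real {x | c < x.1 / I x.2} <
      (G.prod μ').real {x | c < x.1 / I' x.2} := by
  have hm : 0 < ∫ g, g ∂G := by
    rw [integral_pos_iff_support_of_nonneg_ae (hG0.mono fun g hg => le_of_lt hg) hG]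
    have : G (Function.support fun g : ℝ => g) = 1 := by
      rw [← measure_univ (μ := G)]
      exact measure_congr (Filter.eventuallyEq_univ.2 (hG0.mono fun g hg => ne_of_gt hg))
    rw [this]
    exact one_pos
  -- Times `c`, the tails are at most `a E g` and at least `b E (g exp (-k g / c))`; the latter
  -- tends to `b E g > a E g`.
  have hlim : Filter.Tendsto (fun c : ℝ => b * ∫ g, g * Real.exp (-(k * (g / c))) ∂G)
      Filter.atTop (nhds (b * ∫ g, g ∂G)) := by
    refine Filter.Tendsto.const_mul _ (tendsto_integral_filter_of_dominated_convergence
      (fun g => g) (Filter.Eventually.of_forall fun c => by fun_prop) ?_ hG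
      (ae_of_all _ fun g => ?_))
    · filter_upwards [Filter.eventually_gt_atTop 0] with c hc
      filter_upwards [hG0] with g hg
      rw [Real.norm_of_nonneg (by positivity)]
      exact mul_le_of_le_one_right hg.le
        (Real.exp_le_one_iff.2 (neg_nonpos.2 (by positivity)))
    · have h1 : Filter.Tendsto (fun c : ℝ => -(k * (g / c))) Filter.atTop (nhds (-(k * 0))) :=
        ((Filter.Tendsto.const_div_atTop Filter.tendsto_id g).const_mul k).neg
      have h2 := ((Real.continuous_exp.tendsto _).comp h1).const_mul g
      simpa using h2
  have hlt : a * ∫ g, g ∂G < b * ∫ g, g ∂G := by gcongr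
  obtain ⟨c, hc, hc0⟩ :=
    ((hlim.eventually_const_lt hlt).and (Filter.eventually_gt_atTop (0 : ℝ))).exists
  refine ⟨c, hc0, ?_⟩
  have hint : Integrable (fun g => g * Real.exp (-(k * (g / c)))) G := by
    refine hG.mono' (by fun_prop) ?_
    filter_upwards [hG0] with g hg
    rw [Real.norm_of_nonneg (by positivity)]
    exact mul_le_of_le_one_right hg.le (Real.exp_le_one_iff.2 (neg_nonpos.2 (by positivity)))
  have hb : 0 < b := lt_of_le_of_lt ha hab
  have h1 : (G.prod μ) {x | c < x.1 / I x.2} ≤ ENNReal.ofReal (c⁻¹ * (a * ∫ g, g ∂G)) := by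
    rw [prod_setOf_lt_div_eq_lintegral G hI hI0 hc0, ← integral_const_mul, ← integral_const_mul,
      ofReal_integral_eq_lintegral_ofReal ((hG.const_mul _).const_mul _)]
    · refine lintegral_mono_ae ?_
      filter_upwards [hG0] with g hg
      refine (hle _ (by positivity)).trans_eq ?_
      congr 1
      ring
    · filter_upwards [hG0] with g hg
      simp only [Pi.zero_apply]
      positivity
  have h2 : ENNReal.ofReal (c⁻¹ * (b * ∫ g, g * Real.exp (-(k * (g / c))) ∂G)) ≤
      (G.prod μ') {x | c < x.1 / I' x.2} := by
    rw [prod_setOf_lt_div_eq_lintegral G hI' hI0' hc0, ← integral_const_mul, ← integral_const_mul,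
      ofReal_integral_eq_lintegral_ofReal ((hint.const_mul _).const_mul _)]
    · refine lintegral_mono_ae ?_
      filter_upwards [hG0] with g hg
      refine le_trans (le_of_eq ?_) (hge _ (by positivity))
      congr 1
      ring
    · filter_upwards [hG0] with g hg
      simp only [Pi.zero_apply]
      positivity
  have h3 : ENNReal.ofReal (c⁻¹ * (a * ∫ g, g ∂G)) <
      ENNReal.ofReal (c⁻¹ * (b * ∫ g, g * Real.exp (-(k * (g / c))) ∂G)) := by
    have h0 : 0 ≤ a * ∫ g, g ∂G := by positivity
    rw [ENNReal.ofReal_lt_ofReal_iff (mul_pos (inv_pos.2 hc0) (h0.trans_lt hc))]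
    gcongr
  exact ENNReal.toReal_strict_mono (measure_ne_top _ _) (h1.trans_lt (h3.trans_le h2))

end Ratio

/-! ### Normal pairs and diagonal quadratic forms. -/

/-- The centred normal law with variance `1 / 2`, whose density is proportional to
`exp (-x ^ 2)`. -/
noncomputable def halfNormal : Measure ℝ := gaussianReal 0 (1 / 2)

instance : IsProbabilityMeasure halfNormal := by unfold halfNormal; infer_instance

instance : NullSingletonClass halfNormal := nullSingletonClass_gaussianReal (by norm_num)

lemma halfNormal_eq_withDensity : halfNormal =
    volume.withDensity fun x => ENNReal.ofReal ((√Real.pi)⁻¹ * Real.exp (-x ^ 2)) := by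
  rw [halfNormal, gaussianReal_of_var_ne_zero _ (by norm_num)]
  congr 1
  ext x
  have h : 2 * ((1 / 2 : NNReal) : ℝ) = 1 := by norm_num
  rw [gaussianPDF, gaussianPDFReal, mul_right_comm, h, one_mul, sub_zero, div_one]

lemma lintegral_halfNormal {f : ℝ → ENNReal} (hf : Measurable f) :
    ∫⁻ x, f x ∂halfNormal =
      ∫⁻ x, ENNReal.ofReal ((√Real.pi)⁻¹ * Real.exp (-x ^ 2)) * f x := by
  rw [halfNormal_eq_withDensity, lintegral_withDensity_eq_lintegral_mul _ (by fun_prop) hf]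
  rfl

lemma lintegral_eq_two_mul_lintegral_Ioi {h : ℝ → ENNReal} (hh : Measurable h)
    (heven : ∀ x, h (-x) = h x) : ∫⁻ x, h x = 2 * ∫⁻ x in Set.Ioi 0, h x := by
  have h1 : ∫⁻ x in Set.Iio (0 : ℝ), h x = ∫⁻ x in Set.Ioi 0, h x := by
    have := (Measure.measurePreserving_neg (volume : Measure ℝ)).setLIntegral_comp_preimage
      (measurableSet_Ioi (a := (0 : ℝ))) hh
    simpa [heven] using this
  rw [← lintegral_add_compl _ (measurableSet_Ici (a := (0 : ℝ))), Set.compl_Ici, h1,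
    ← restrict_Ioi_eq_restrict_Ici, two_mul]

/-- The square of a centred normal variable with variance `1 / 2` has the gamma law with shape
`1 / 2` and scale `1`. -/
lemma map_sq_halfNormal : halfNormal.map (fun x => x ^ 2) = gammaLaw (1 / 2) 1 := by
  refine Measure.ext_of_lintegral _ fun f hf => ?_
  have himg : (fun x : ℝ => x ^ 2) '' Set.Ioi 0 = Set.Ioi 0 := by
    ext y
    refine ⟨?_, fun hy => ⟨√y, Real.sqrt_pos.2 hy, Real.sq_sqrt (le_of_lt hy)⟩⟩
    rintro ⟨x, hx, rfl⟩
    exact pow_pos (Set.mem_Ioi.1 hx) 2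
  have hinj : Set.InjOn (fun x : ℝ => x ^ 2) (Set.Ioi 0) := fun x hx y hy h =>
    (pow_left_inj₀ (le_of_lt hx) (le_of_lt hy) two_ne_zero).1 h
  have hderiv : ∀ x ∈ Set.Ioi (0 : ℝ),
      HasDerivWithinAt (fun x : ℝ => x ^ 2) (2 * x) (Set.Ioi 0) x := fun x _ => by
    simpa using (hasDerivAt_pow 2 x).hasDerivWithinAt
  -- Evenness folds the integral onto `(0, ∞)`, where squaring is injective and the change of
  -- variables formula applies.
  rw [lintegral_map hf (by fun_prop), lintegral_halfNormal (f := fun x => f (x ^ 2))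
      (by fun_prop),
    lintegral_eq_two_mul_lintegral_Ioi (by fun_prop) (fun x => by simp), lintegral_gammaLaw hf]
  conv_rhs => rw [← himg]
  rw [lintegral_image_eq_lintegral_abs_deriv_mul measurableSet_Ioi hderiv hinj,
    ← lintegral_const_mul _ (by fun_prop)]
  refine setLIntegral_congr_fun measurableSet_Ioi fun x hx => ?_
  have hx : 0 < x := hx
  rw [← mul_assoc, ← mul_assoc, ← ENNReal.ofReal_mul (abs_nonneg _), ← ENNReal.ofReal_ofNat,
    ← ENNReal.ofReal_mul zero_le_two]
  congr 2
  have h1 : (x ^ 2) ^ ((1 : ℝ) / 2 - 1) = x⁻¹ := by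
    rw [← Real.rpow_natCast_mul hx.le, ← Real.rpow_neg_one]
    norm_num
  rw [h1, abs_of_pos (by positivity), Real.Gamma_one_half_eq]
  simp
  field_simp

/-- The law of two independent centred normal variables with variance `1 / 2`. -/
noncomputable def halfNormalPair : Measure (ℝ × ℝ) := halfNormal.prod halfNormal

instance : IsProbabilityMeasure halfNormalPair := by unfold halfNormalPair; infer_instance

lemma halfNormalPair_eq_withDensity : halfNormalPair = (volume : Measure (ℝ × ℝ)).withDensity
    fun x => ENNReal.ofReal (Real.pi⁻¹ * Real.exp (-(x.1 ^ 2 + x.2 ^ 2))) := by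
  rw [halfNormalPair, halfNormal_eq_withDensity, prod_withDensity (by fun_prop) (by fun_prop)]
  congr 1
  ext x
  rw [← ENNReal.ofReal_mul (by positivity)]
  congr 1
  rw [mul_mul_mul_comm, ← mul_inv, Real.mul_self_sqrt Real.pi_pos.le, ← Real.exp_add, neg_add]

/-- Off this null set the forms below are positive and the convexity inequality for their moments is
strict. -/
lemma ae_sq_ne_sq_halfNormalPair : ∀ᵐ x ∂halfNormalPair, x.1 ^ 2 ≠ x.2 ^ 2 := by
  have hmeas : MeasurableSet {x : ℝ × ℝ | x.1 ^ 2 = x.2 ^ 2} :=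
    measurableSet_eq_fun (by fun_prop) (by fun_prop)
  have h : halfNormalPair {x : ℝ × ℝ | x.1 ^ 2 = x.2 ^ 2} = 0 := by
    rw [halfNormalPair, Measure.measure_prod_null hmeas]
    refine ae_of_all _ fun u => ?_
    refine Set.Finite.measure_zero ((Set.toFinite {u, -u}).subset fun v hv => ?_) _
    have hv : u ^ 2 = v ^ 2 := hv
    rcases sq_eq_sq_iff_eq_or_eq_neg.1 hv.symm with h | h <;> simp [h]
  simpa [ae_iff] using h

/-- The quadratic form `a * u ^ 2 + b * v ^ 2`. -/
def diagForm (a b : ℝ) (x : ℝ × ℝ) : ℝ := a * x.1 ^ 2 + b * x.2 ^ 2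

@[fun_prop]
lemma measurable_diagForm (a b : ℝ) : Measurable (diagForm a b) := by
  unfold diagForm
  fun_prop

lemma ae_diagForm_pos {a b : ℝ} (ha : 0 < a) (hb : 0 < b) :
    ∀ᵐ x ∂halfNormalPair, 0 < diagForm a b x := by
  filter_upwards [ae_sq_ne_sq_halfNormalPair] with x hx
  rcases (sq_nonneg x.1).eq_or_lt with h | h
  · have : 0 < x.2 ^ 2 := lt_of_le_of_ne (sq_nonneg _) (h ▸ hx)
    unfold diagForm
    positivity
  · unfold diagForm
    positivity

lemma diagForm_nonneg {a b : ℝ} (ha : 0 < a) (hb : 0 < b) (x : ℝ × ℝ) : 0 ≤ diagForm a b x := by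
  unfold diagForm
  positivity

/-- The form is at most twice its larger term, so gamma moments of shape `1/2` dominate. -/
lemma integrable_diagForm_rpow {a b p : ℝ} (ha : 0 < a) (hb : 0 < b) (hp : 0 < p) :
    Integrable (fun x => diagForm a b x ^ p) halfNormalPair := by
  have h1 : Integrable (fun u : ℝ => (u ^ 2) ^ p) halfNormal := by
    have h : Integrable (fun x : ℝ => x ^ p) (halfNormal.map fun u => u ^ 2) := by
      rw [map_sq_halfNormal]
      exact integrable_rpow_gammaLaw (by norm_num) one_pos hp.le
    exact h.comp_measurable (by fun_prop)
  have h2 : Integrable (fun x : ℝ × ℝ => (x.1 ^ 2) ^ p) halfNormalPair := h1.comp_fst _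
  have h3 : Integrable (fun x : ℝ × ℝ => (x.2 ^ 2) ^ p) halfNormalPair := h1.comp_snd _
  refine ((h2.const_mul ((2 * a) ^ p)).add (h3.const_mul ((2 * b) ^ p))).mono'
    ((measurable_diagForm a b).pow_const p).aestronglyMeasurable (ae_of_all _ fun x => ?_)
  have hn := diagForm_nonneg ha hb x
  rw [Real.norm_of_nonneg (Real.rpow_nonneg hn _), Pi.add_apply,
    ← Real.mul_rpow (by positivity) (sq_nonneg _), ← Real.mul_rpow (by positivity) (sq_nonneg _)]
  rcases le_total (a * x.1 ^ 2) (b * x.2 ^ 2) with h | h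
  · refine (Real.rpow_le_rpow hn (z := p) (y := 2 * b * x.2 ^ 2) ?_ hp.le).trans
      (le_add_of_nonneg_left (by positivity))
    unfold diagForm
    linarith
  · refine (Real.rpow_le_rpow hn (z := p) (y := 2 * a * x.1 ^ 2) ?_ hp.le).trans
      (le_add_of_nonneg_right (by positivity))
    unfold diagForm
    linarith

/-- Among the forms `a * u ^ 2 + b * v ^ 2` with `a + b = 2` the balanced one has the smallest
moments of order `p > 1`. -/
lemma integral_diagForm_one_one_rpow_lt {a b p : ℝ} (ha : 0 < a) (hb : 0 < b) (hab : a + b = 2)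
    (hne : a ≠ b) (hp : 1 < p) :
    ∫ x, diagForm 1 1 x ^ p ∂halfNormalPair < ∫ x, diagForm a b x ^ p ∂halfNormalPair := by
  have hp0 : 0 < p := by linarith
  have hI := integrable_diagForm_rpow ha hb hp0
  have hI' := integrable_diagForm_rpow hb ha hp0
  have hI1 := integrable_diagForm_rpow one_pos one_pos hp0
  -- Exchanging `u` and `v` preserves the law, and the average of the form and its exchange is `u² +
  -- v²` because `a + b = 2`; convexity is applied to this average.
  have hswap : ∫ x, diagForm b a x ^ p ∂halfNormalPair = ∫ x, diagForm a b x ^ p ∂halfNormalPair := by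
    rw [halfNormalPair, ← integral_prod_swap]
    refine integral_congr_ae (ae_of_all _ fun x => ?_)
    simp [diagForm, add_comm]
  have hD : ∀ x, 0 ≤ (1 / 2) * diagForm a b x ^ p + (1 / 2) * diagForm b a x ^ p -
      diagForm 1 1 x ^ p ∧ (x.1 ^ 2 ≠ x.2 ^ 2 → 0 < (1 / 2) * diagForm a b x ^ p +
        (1 / 2) * diagForm b a x ^ p - diagForm 1 1 x ^ p) := by
    intro x
    have hmid : (1 / 2 : ℝ) • diagForm a b x + (1 / 2 : ℝ) • diagForm b a x = diagForm 1 1 x := by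
      have : b = 2 - a := by linarith
      simp only [diagForm, smul_eq_mul, this]
      ring
    constructor
    · have := (strictConvexOn_rpow hp).convexOn.2 (diagForm_nonneg ha hb x)
        (diagForm_nonneg hb ha x) (by norm_num : (0 : ℝ) ≤ 1 / 2) (by norm_num : (0 : ℝ) ≤ 1 / 2)
        (by norm_num)
      rw [hmid] at this
      simp only [smul_eq_mul] at this
      linarith
    · intro hx
      have hne' : diagForm a b x ≠ diagForm b a x := by
        intro h
        have : (a - b) * (x.1 ^ 2 - x.2 ^ 2) = 0 := by
          simp only [diagForm] at h
          linarith
        rcases mul_eq_zero.1 this with h | h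
        · exact hne (sub_eq_zero.1 h)
        · exact hx (sub_eq_zero.1 h)
      have := (strictConvexOn_rpow hp).2 (diagForm_nonneg ha hb x)
        (diagForm_nonneg hb ha x) hne' (by norm_num : (0 : ℝ) < 1 / 2)
        (by norm_num : (0 : ℝ) < 1 / 2) (by norm_num)
      rw [hmid] at this
      simp only [smul_eq_mul] at this
      linarith
  have hadd : Integrable (fun x => (1 / 2) * diagForm a b x ^ p + (1 / 2) * diagForm b a x ^ p)
      halfNormalPair := (hI.const_mul _).add (hI'.const_mul _)
  have hpos : 0 < ∫ x, ((1 / 2) * diagForm a b x ^ p + (1 / 2) * diagForm b a x ^ p -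
      diagForm 1 1 x ^ p) ∂halfNormalPair := by
    refine (integral_pos_iff_support_of_nonneg (fun x => (hD x).1) (hadd.sub hI1)).2 ?_
    exact lt_of_lt_of_eq one_pos (measure_univ.symm.trans (measure_congr
      (Filter.eventuallyEq_univ.2
        (ae_sq_ne_sq_halfNormalPair.mono fun x hx => ((hD x).2 hx).ne'))).symm)
  rw [integral_sub hadd hI1,
    integral_add (hI.const_mul _) (hI'.const_mul _), integral_const_mul, integral_const_mul,
    hswap] at hpos
  linarith

/-- The area of an ellipse, in terms of the area of the unit disc. -/
lemma volume_diagForm_lt {a b q y : ℝ} (ha : 0 < a) (hb : 0 < b) (hq : 0 < q) (hab : q ^ 2 = a * b)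
    (hy : 0 < y) : (volume : Measure (ℝ × ℝ)) {x | diagForm a b x < y} =
      ENNReal.ofReal (y / q) * volume {x : ℝ × ℝ | diagForm 1 1 x < 1} := by
  have hα : 0 < √(a / y) := Real.sqrt_pos.2 (by positivity)
  have hβ : 0 < √(b / y) := Real.sqrt_pos.2 (by positivity)
  have hmeas : Measurable (Prod.map (fun x => √(a / y) * x) fun x => √(b / y) * x) := by fun_prop
  have hset : {x : ℝ × ℝ | diagForm a b x < y} =
      Prod.map (fun x => √(a / y) * x) (fun x => √(b / y) * x) ⁻¹'
        {x : ℝ × ℝ | diagForm 1 1 x < 1} := by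
    ext x
    simp only [Set.mem_ofPred_eq, Set.mem_preimage, diagForm, Prod.map_fst, Prod.map_snd, mul_pow,
      Real.sq_sqrt (show 0 ≤ a / y by positivity), Real.sq_sqrt (show 0 ≤ b / y by positivity)]
    rw [← div_lt_one hy]
    ring_nf
  rw [hset, ← Measure.map_apply hmeas (measurableSet_lt (by fun_prop) (by fun_prop)),
    Measure.volume_eq_prod, ← Measure.map_prod_map _ _ (by fun_prop) (by fun_prop),
    Real.map_volume_mul_left hα.ne', Real.map_volume_mul_left hβ.ne', Measure.prod_smul_left,
    Measure.prod_smul_right, smul_smul, Measure.smul_apply, smul_eq_mul,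
    ← ENNReal.ofReal_mul (abs_nonneg _), ← abs_mul, ← mul_inv,
    ← Real.sqrt_mul (by positivity), show a / y * (b / y) = (q / y) ^ 2 by
      rw [div_pow, hab]; ring, Real.sqrt_sq (by positivity), abs_of_pos (by positivity), inv_div]

lemma volume_unitDisc_pos : 0 < (volume : Measure (ℝ × ℝ)) {x | diagForm 1 1 x < 1} := by
  have hopen : IsOpen {x : ℝ × ℝ | diagForm 1 1 x < 1} := by
    unfold diagForm
    exact isOpen_lt (by fun_prop) continuous_const
  exact hopen.measure_pos _ ⟨0, by simp [diagForm]⟩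

lemma volume_unitDisc_lt_top : (volume : Measure (ℝ × ℝ)) {x | diagForm 1 1 x < 1} < ⊤ := by
  refine lt_of_le_of_lt (measure_mono (t := Set.Icc (-1) 1 ×ˢ Set.Icc (-1) 1) fun x hx => ?_)
    (isCompact_Icc.prod isCompact_Icc).measure_lt_top
  have hx : 1 * x.1 ^ 2 + 1 * x.2 ^ 2 < 1 := hx
  refine ⟨abs_le.1 (abs_le_one_iff_mul_self_le_one.2 ?_),
    abs_le.1 (abs_le_one_iff_mul_self_le_one.2 ?_)⟩ <;> nlinarith [sq_nonneg x.1, sq_nonneg x.2]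

/-- The joint density is at most `1 / π`. The area of the unit disc is left unevaluated: it enters
both comparison bounds as a common factor. -/
lemma halfNormalPair_diagForm_one_one_lt_le {y : ℝ} (hy : 0 < y) :
    halfNormalPair {x | diagForm 1 1 x < y} ≤ ENNReal.ofReal
      (Real.pi⁻¹ * ((volume : Measure (ℝ × ℝ)) {x | diagForm 1 1 x < 1}).toReal * y) := by
  have hs : MeasurableSet {x | diagForm 1 1 x < y} := measurableSet_lt (by fun_prop) (by fun_prop)
  rw [halfNormalPair_eq_withDensity, withDensity_apply _ hs]
  calc _ ≤ ∫⁻ x in {x | diagForm 1 1 x < y}, ENNReal.ofReal Real.pi⁻¹ := by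
        refine lintegral_mono fun x => ENNReal.ofReal_le_ofReal ?_
        exact mul_le_of_le_one_right (by positivity)
          (Real.exp_le_one_iff.2 (neg_nonpos.2 (by positivity)))
    _ = _ := by
        rw [setLIntegral_const, volume_diagForm_lt one_pos one_pos one_pos (by norm_num) hy,
          ← ENNReal.ofReal_toReal volume_unitDisc_lt_top.ne, ENNReal.toReal_ofReal (by positivity),
          ← ENNReal.ofReal_mul (by positivity), ← ENNReal.ofReal_mul (by positivity)]
        congr 1
        ring

/-- On the ellipse `u² + v² ≤ y / b`, as `b` is the smaller coefficient, which bounds the density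
from below. -/
lemma le_halfNormalPair_diagForm_lt {a b q y : ℝ} (hb : 0 < b) (hba : b ≤ a) (hq : 0 < q)
    (hab : q ^ 2 = a * b) (hy : 0 < y) :
    ENNReal.ofReal (Real.pi⁻¹ * ((volume : Measure (ℝ × ℝ)) {x | diagForm 1 1 x < 1}).toReal / q *
      (y * Real.exp (-(b⁻¹ * y)))) ≤ halfNormalPair {x | diagForm a b x < y} := by
  have ha : 0 < a := hb.trans_le hba
  have hs : MeasurableSet {x | diagForm a b x < y} := measurableSet_lt (by fun_prop) (by fun_prop)
  rw [halfNormalPair_eq_withDensity, withDensity_apply _ hs]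
  calc _ = ∫⁻ x in {x | diagForm a b x < y},
        ENNReal.ofReal (Real.pi⁻¹ * Real.exp (-(b⁻¹ * y))) := by
        rw [setLIntegral_const, volume_diagForm_lt ha hb hq hab hy,
          ← ENNReal.ofReal_toReal volume_unitDisc_lt_top.ne, ENNReal.toReal_ofReal (by positivity),
          ← ENNReal.ofReal_mul (by positivity), ← ENNReal.ofReal_mul (by positivity)]
        congr 1
        ring
    _ ≤ _ := by
        refine setLIntegral_mono (by fun_prop) fun x hx => ENNReal.ofReal_le_ofReal ?_
        have hx : a * x.1 ^ 2 + b * x.2 ^ 2 < y := hx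
        have : x.1 ^ 2 + x.2 ^ 2 ≤ b⁻¹ * y := by
          rw [le_inv_mul_iff₀ hb]
          nlinarith [sq_nonneg x.1]
        gcongr

lemma integral_halfNormal (f : ℝ → ℝ) :
    ∫ x, f x ∂halfNormal = (√Real.pi)⁻¹ * ∫ x, Real.exp (-x ^ 2) * f x := by
  rw [halfNormal_eq_withDensity, integral_withDensity_eq_integral_toReal_smul (by fun_prop)
    (ae_of_all _ fun x => ENNReal.ofReal_lt_top), ← integral_const_mul]
  refine integral_congr_ae (ae_of_all _ fun x => ?_)
  simp only [smul_eq_mul]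
  rw [ENNReal.toReal_ofReal (by positivity), mul_assoc]

lemma integral_exp_quadratic_halfNormal {P : ℝ} (hP : -1 < P) (B : ℝ) :
    ∫ x, Real.exp (-(P * x ^ 2 + 2 * B * x)) ∂halfNormal =
      (√(1 + P))⁻¹ * Real.exp (B ^ 2 / (1 + P)) := by
  have hP' : 0 < 1 + P := by linarith
  have h : ∀ x : ℝ, Real.exp (-x ^ 2) * Real.exp (-(P * x ^ 2 + 2 * B * x)) =
      Real.exp (B ^ 2 / (1 + P)) * Real.exp (-(1 + P) * (x + B / (1 + P)) ^ 2) := by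
    intro x
    rw [← Real.exp_add, ← Real.exp_add]
    congr 1
    field_simp
    ring
  rw [integral_halfNormal]
  simp_rw [h]
  rw [integral_const_mul, integral_add_right_eq_self (fun x => Real.exp (-(1 + P) * x ^ 2)),
    integral_gaussian, Real.sqrt_div Real.pi_pos.le]
  have : √Real.pi ≠ 0 := (Real.sqrt_pos.2 Real.pi_pos).ne'
  field_simp

/-- The Laplace transform of a quadratic form of two independent normal variables. -/
lemma integral_exp_quadratic_halfNormalPair {P Q R : ℝ} (hP : 0 ≤ P) (hR : 0 ≤ R)
    (hQ : Q ^ 2 ≤ P * R) :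
    ∫ x, Real.exp (-(P * x.1 ^ 2 + 2 * Q * (x.1 * x.2) + R * x.2 ^ 2)) ∂halfNormalPair =
      ((1 + P) * (1 + R) - Q ^ 2) ^ (-(1 / 2) : ℝ) := by
  have hP' : 0 < 1 + P := by linarith
  have hnonneg : ∀ u v : ℝ, 0 ≤ P * u ^ 2 + 2 * Q * (u * v) + R * v ^ 2 := by
    intro u v
    rcases hP.eq_or_lt with h | h
    · have hQ0 : Q = 0 := by nlinarith [sq_nonneg Q]
      rw [← h, hQ0]
      nlinarith [mul_nonneg hR (sq_nonneg v)]
    · have : 0 ≤ P * (P * u ^ 2 + 2 * Q * (u * v) + R * v ^ 2) := by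
        nlinarith [sq_nonneg (P * u + Q * v), mul_nonneg (sub_nonneg.2 hQ) (sq_nonneg v)]
      exact nonneg_of_mul_nonneg_right this h
  have hint : Integrable (fun x : ℝ × ℝ =>
      Real.exp (-(P * x.1 ^ 2 + 2 * Q * (x.1 * x.2) + R * x.2 ^ 2)))
      (halfNormal.prod halfNormal) := by
    refine Integrable.of_bound (by fun_prop) 1 (ae_of_all _ fun x => ?_)
    rw [Real.norm_of_nonneg (Real.exp_pos _).le]
    exact Real.exp_le_one_iff.2 (neg_nonpos.2 (hnonneg _ _))
  -- Completing the square in `u` leaves the Schur complement `R - Q² / (1 + P)` as coefficient of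
  -- `v²`.
  have hinner : ∀ v : ℝ, ∫ u, Real.exp (-(P * u ^ 2 + 2 * Q * (u * v) + R * v ^ 2)) ∂halfNormal =
      (√(1 + P))⁻¹ * Real.exp (-((R - Q ^ 2 / (1 + P)) * v ^ 2 + 2 * 0 * v)) := by
    intro v
    have h : ∀ u : ℝ, Real.exp (-(P * u ^ 2 + 2 * Q * (u * v) + R * v ^ 2)) =
        Real.exp (-(R * v ^ 2)) * Real.exp (-(P * u ^ 2 + 2 * (Q * v) * u)) := by
      intro u
      rw [← Real.exp_add]
      ring_nf
    simp_rw [h]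
    rw [integral_const_mul, integral_exp_quadratic_halfNormal (by linarith), mul_left_comm,
      ← Real.exp_add]
    congr 2
    ring
  have hS : -1 < R - Q ^ 2 / (1 + P) := by
    have : Q ^ 2 / (1 + P) ≤ R := by
      rw [div_le_iff₀ hP']
      nlinarith
    linarith
  rw [halfNormalPair, integral_prod_symm _ hint]
  simp_rw [hinner]
  rw [integral_const_mul, integral_exp_quadratic_halfNormal hS, ← mul_assoc, ← mul_inv,
    ← Real.sqrt_mul hP'.le, Real.rpow_neg (by nlinarith), ← Real.sqrt_eq_rpow]
  have : (1 + P) * (1 + (R - Q ^ 2 / (1 + P))) = (1 + P) * (1 + R) - Q ^ 2 := by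
    field_simp
    ring
  rw [this]
  simp

/-! ### The network for user shape larger than one. -/

namespace Network

/-- Two interferers at equal distance, with shape parameter `1 / 2`. -/
noncomputable def twoInterferers (p : ℝ) (hp : 0 < p) : Network 2 where
  power := 1
  β := 2
  r := 1 / 2
  d := fun _ => 1
  αu := p
  θu := 1
  αc := 1 / 2
  θ := fun _ => 1
  power_pos := one_pos
  r_pos := by norm_num
  d_pos := fun _ => one_pos
  αu_pos := hp
  θu_pos := one_pos
  αc_pos := by norm_num
  θ_pos := fun _ => one_pos

end Network

/-- The squares of two correlated centred normal variables with variance `1 / 2`. -/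
noncomputable def corrSquares (x : ℝ × ℝ) : Fin 2 → ℝ :=
  -- Since `16/25 + 9/25 = 1`, both normals keep variance `1/2`; their correlation is `16/25 - 9/25
  -- = 7/25`. The squares add up to `32/25 u² + 18/25 v²`, whose coefficients have product
  -- `(24/25)²`, less than `1` and with rational root.
  ![(4 / 5 * x.1 + 3 / 5 * x.2) ^ 2, (4 / 5 * x.1 - 3 / 5 * x.2) ^ 2]

lemma measurable_corrSquares : Measurable corrSquares := by
  refine measurable_pi_iff.2 fun i => ?_
  fin_cases i <;> simp [corrSquares] <;> fun_prop

/-- The correlation coefficient of the two entries of `corrSquares`. -/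
noncomputable def squaresCorr : Fin 2 → Fin 2 → ℝ := fun _ _ => (7 / 25) ^ 2

lemma corrMatrix_squaresCorr : corrMatrix squaresCorr = !![1, 7 / 25; 7 / 25, 1] := by
  have h : √((7 / 25 : ℝ) ^ 2) = 7 / 25 := Real.sqrt_sq (by norm_num)
  ext i j
  fin_cases i <;> fin_cases j <;> simp [corrMatrix, squaresCorr, h]

lemma isCorrelation_squaresCorr : IsCorrelation squaresCorr where
  symm := fun _ _ => rfl
  nonneg := fun _ _ => by norm_num [squaresCorr]
  le_one := fun _ _ => by norm_num [squaresCorr]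
  posDef := by
    rw [corrMatrix_squaresCorr]
    refine Matrix.PosDef.of_dotProduct_mulVec_pos ?_ fun x hx => ?_
    · ext i j
      fin_cases i <;> fin_cases j <;> simp
    · have hx' : x 0 ≠ 0 ∨ x 1 ≠ 0 := by
        by_contra! h
        exact hx (by ext i; fin_cases i <;> simp [h])
      have h1 : 0 < x 0 ^ 2 + x 1 ^ 2 := by
        rcases hx' with h | h <;> positivity
      simp [dotProduct, Matrix.mulVec, Fin.sum_univ_two]
      nlinarith [sq_nonneg (x 0 + x 1)]

/-- The exponent is a quadratic form in the normal pair, so the Gaussian integral gives a `2 × 2`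
determinant to the power `-1/2`, which is the required transform at `αc = 1/2`. -/
lemma isCorrelatedLaw_map_corrSquares {p : ℝ} (hp : 0 < p) :
    (Network.twoInterferers p hp).IsCorrelatedLaw squaresCorr
      (halfNormalPair.map corrSquares) where
  isProbabilityMeasure := Measure.isProbabilityMeasure_map measurable_corrSquares.aemeasurable
  nonneg := by
    rw [ae_map_iff measurable_corrSquares.aemeasurable (by measurability)]
    refine ae_of_all _ fun x i => ?_
    fin_cases i <;> simp [corrSquares] <;> positivity
  laplace := by
    intro s hs
    have hs0 := hs 0
    have hs1 := hs 1
    rw [integral_map measurable_corrSquares.aemeasurable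
      (Measurable.aestronglyMeasurable (by fun_prop)), corrMatrix_squaresCorr]
    have h : ∀ x : ℝ × ℝ, ∑ i, s i * corrSquares x i = 16 / 25 * (s 0 + s 1) * x.1 ^ 2 +
        2 * (12 / 25 * (s 0 - s 1)) * (x.1 * x.2) + 9 / 25 * (s 0 + s 1) * x.2 ^ 2 := by
      intro x
      simp [corrSquares, Fin.sum_univ_two]
      ring
    simp_rw [h]
    rw [integral_exp_quadratic_halfNormalPair (by positivity) (by positivity)
      (by nlinarith [mul_nonneg hs0 hs1])]
    simp only [Network.twoInterferers, Matrix.det_fin_two]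
    congr 1
    simp
    ring

lemma indepLaw_twoInterferers {p : ℝ} (hp : 0 < p) :
    (Network.twoInterferers p hp).indepLaw =
      halfNormalPair.map fun x => ![x.1 ^ 2, x.2 ^ 2] := by
  have h := (measurePreserving_finTwoArrow halfNormal).symm.map_eq
  have hm : (Measure.pi fun _ : Fin 2 => halfNormal).map (fun x i => (x i) ^ 2) =
      Measure.pi fun _ : Fin 2 => gammaLaw (1 / 2) 1 := by
    rw [← map_sq_halfNormal]
    have : IsProbabilityMeasure (halfNormal.map fun x => x ^ 2) :=
      Measure.isProbabilityMeasure_map (by fun_prop)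
    exact Measure.pi_map_pi (μ := fun _ : Fin 2 => halfNormal) (f := fun _ x => x ^ 2)
      (fun _ => by fun_prop)
  change (Measure.pi fun _ : Fin 2 => gammaLaw (1 / 2) 1) = _
  rw [← hm, ← h, Measure.map_map (by fun_prop) (MeasurableEquiv.measurable _), halfNormalPair]
  congr 1
  ext x i
  fin_cases i <;> rfl

/-- The threshold `4 * c` absorbs the user's path gain `(1/2) ^ (-2) = 4`. -/
lemma coverage_twoInterferers_map {p : ℝ} (hp : 0 < p) {Φ : ℝ × ℝ → Fin 2 → ℝ}
    (hΦ : Measurable Φ) {a b : ℝ} (hsum : ∀ x, Φ x 0 + Φ x 1 = diagForm a b x) (c : ℝ) :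
    (Network.twoInterferers p hp).coverage (halfNormalPair.map Φ) (4 * c) =
      ((gammaLaw p 1).prod halfNormalPair).real {x | c < x.1 / diagForm a b x.2} := by
  have := isProbabilityMeasure_gammaLaw hp one_pos
  have hI : ∀ h, (Network.twoInterferers p hp).interference h = h 0 + h 1 := by
    intro h
    simp [Network.interference, Network.twoInterferers, Fin.sum_univ_two]
  have hT : 4 * c / (Network.twoInterferers p hp).r ^ (-(Network.twoInterferers p hp).β) = c := by
    have : ((1 / 2 : ℝ)) ^ (-2 : ℝ) = 4 := by
      rw [Real.rpow_neg (by norm_num)]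
      norm_num
    simp only [Network.twoInterferers, this]
    ring
  have hmap : (gammaLaw p 1).prod (halfNormalPair.map Φ) =
      ((gammaLaw p 1).prod halfNormalPair).map (Prod.map id Φ) := by
    rw [← Measure.map_prod_map _ _ measurable_id hΦ, Measure.map_id]
  rw [Network.coverage_eq, hT]
  change ((gammaLaw p 1).prod (halfNormalPair.map Φ)).real _ = _
  rw [hmap, measureReal_def, Measure.map_apply (measurable_id.prodMap hΦ)
    (measurableSet_lt_div (Network.measurable_interference _) c), measureReal_def]
  congr 2
  ext x
  simp [hI, hsum]

lemma coverage_twoInterferers_indepLaw {p : ℝ} (hp : 0 < p) (c : ℝ) :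
    (Network.twoInterferers p hp).coverage (Network.twoInterferers p hp).indepLaw (4 * c) =
      ((gammaLaw p 1).prod halfNormalPair).real {x | c < x.1 / diagForm 1 1 x.2} := by
  rw [indepLaw_twoInterferers]
  refine coverage_twoInterferers_map hp ?_ (fun x => by simp [diagForm]) c
  refine measurable_pi_iff.2 fun i => ?_
  fin_cases i <;> simp <;> fun_prop

lemma coverage_twoInterferers_corrSquares {p : ℝ} (hp : 0 < p) (c : ℝ) :
    (Network.twoInterferers p hp).coverage (halfNormalPair.map corrSquares) (4 * c) =
      ((gammaLaw p 1).prod halfNormalPair).real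
        {x | c < x.1 / diagForm (32 / 25) (18 / 25) x.2} := by
  refine coverage_twoInterferers_map hp measurable_corrSquares (fun x => ?_) c
  simp [corrSquares, diagForm]
  ring

lemma exists_coverage_corrSquares_lt {p : ℝ} (hp : 0 < p) (hp1 : 1 < p) : ∃ T, 0 < T ∧
    (Network.twoInterferers p hp).coverage (halfNormalPair.map corrSquares) T <
      (Network.twoInterferers p hp).coverage (Network.twoInterferers p hp).indepLaw T := by
  obtain ⟨c, hc, h⟩ := exists_prod_gammaLaw_lt_of_integral_rpow_lt hp
    (measurable_diagForm 1 1) (ae_diagForm_pos one_pos one_pos)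
    (measurable_diagForm (32 / 25) (18 / 25)) (ae_diagForm_pos (by norm_num) (by norm_num))
    (integrable_diagForm_rpow one_pos one_pos hp)
    (integrable_diagForm_rpow (by norm_num) (by norm_num) hp)
    (integral_diagForm_one_one_rpow_lt (by norm_num) (by norm_num) (by norm_num) (by norm_num) hp1)
  refine ⟨4 * c, by positivity, ?_⟩
  rwa [coverage_twoInterferers_indepLaw, coverage_twoInterferers_corrSquares]

/-- Near `0` the mass of the correlated interference exceeds that of the independent one by the
factor `25/24`. This direction holds for every user shape. -/
lemma exists_lt_coverage_corrSquares {p : ℝ} (hp : 0 < p) : ∃ T, 0 < T ∧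
    (Network.twoInterferers p hp).coverage (Network.twoInterferers p hp).indepLaw T <
      (Network.twoInterferers p hp).coverage (halfNormalPair.map corrSquares) T := by
  have := isProbabilityMeasure_gammaLaw hp one_pos
  have hV := ENNReal.toReal_pos volume_unitDisc_pos.ne' volume_unitDisc_lt_top.ne
  have hV' := mul_pos (inv_pos.2 Real.pi_pos) hV
  have hG : Integrable (fun g => g) (gammaLaw p 1) := by
    simpa using integrable_rpow_gammaLaw hp one_pos zero_le_one
  obtain ⟨c, hc, h⟩ := exists_prod_lt_of_measure_lt_le (ae_pos_gammaLaw p 1) hG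
    (measurable_diagForm 1 1) (ae_diagForm_pos one_pos one_pos)
    (measurable_diagForm (32 / 25) (18 / 25)) (ae_diagForm_pos (by norm_num) (by norm_num))
    hV'.le (by rw [lt_div_iff₀ (by norm_num)]; linarith) (by norm_num)
    (fun y hy => halfNormalPair_diagForm_one_one_lt_le hy)
    (fun y hy => le_halfNormalPair_diagForm_lt (q := 24 / 25) (by norm_num) (by norm_num)
      (by norm_num) (by norm_num) hy)
  refine ⟨4 * c, by positivity, ?_⟩
  rwa [coverage_twoInterferers_indepLaw, coverage_twoInterferers_corrSquares]

theorem theorem3 :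
    -- user channel with shape parameter at most one
    (∀ (N : ℕ) (n : Network N) (ρ : Fin N → Fin N → ℝ) (T : ℝ),
      n.αu ≤ 1 → IsCorrelation ρ → 0 < T →
        -- the interferers are correlated gamma variables
        (∀ ν : Measure (Fin N → ℝ), n.IsCorrelatedLaw ρ ν →
          n.coverage n.indepLaw T ≤ n.coverage ν T) ∧
        -- the total interference is the weighted sum whose scales are the eigenvalues of `A`
        (∀ μ : Fin N → ℝ,
          (n.matrixA ρ).charpoly = ∏ i, (Polynomial.X - Polynomial.C (μ i)) →
            n.coverage n.indepLaw T ≤ n.coverageOfScales μ T)) ∧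
    -- user channel with shape parameter larger than one: the order can go either way
    (∀ αu : ℝ, 1 < αu →
      (∃ (N : ℕ) (n : Network N) (ρ : Fin N → Fin N → ℝ) (ν : Measure (Fin N → ℝ)) (T : ℝ),
        n.αu = αu ∧ 1 / 2 ≤ n.αc ∧ 2 ≤ n.β ∧ (∀ i, n.r < n.d i) ∧ IsCorrelation ρ ∧
          n.IsCorrelatedLaw ρ ν ∧ 0 < T ∧ n.coverage ν T < n.coverage n.indepLaw T) ∧
      (∃ (N : ℕ) (n : Network N) (ρ : Fin N → Fin N → ℝ) (ν : Measure (Fin N → ℝ)) (T : ℝ),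
        n.αu = αu ∧ 1 / 2 ≤ n.αc ∧ 2 ≤ n.β ∧ (∀ i, n.r < n.d i) ∧ IsCorrelation ρ ∧
          n.IsCorrelatedLaw ρ ν ∧ 0 < T ∧ n.coverage n.indepLaw T < n.coverage ν T)) := by
  refine ⟨fun N n ρ T hαu hρ hT => ⟨fun ν hν => n.coverage_indepLaw_le_coverage hαu hρ hν hT,
    fun μ hμ => n.coverage_indepLaw_le_coverageOfScales hαu hρ hμ hT⟩, fun p hp1 => ?_⟩
  have hp : 0 < p := by linarith
  have hr : (1 / 2 : ℝ) < 1 := by norm_num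
  obtain ⟨T, hT, h⟩ := exists_coverage_corrSquares_lt hp hp1
  obtain ⟨T', hT', h'⟩ := exists_lt_coverage_corrSquares hp
  exact ⟨⟨2, Network.twoInterferers p hp, squaresCorr, halfNormalPair.map corrSquares, T,
      rfl, le_rfl, le_rfl, fun _ => hr, isCorrelation_squaresCorr,
      isCorrelatedLaw_map_corrSquares hp, hT, h⟩,
    ⟨2, Network.twoInterferers p hp, squaresCorr, halfNormalPair.map corrSquares, T',
      rfl, le_rfl, le_rfl, fun _ => hr, isCorrelation_squaresCorr,
      isCorrelatedLaw_map_corrSquares hp, hT', h'⟩⟩
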